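/- **Setting.** Fix $T>0$ and a constant $\alpha\ge 0$. A pair of schedules $\eta,\sigma:[0,T]\to\mathbb R$ is *regular* if $\eta,\sigma\in C([0,T])\cap C^\infty((0,T])$, $\eta_t>0$, $\sigma_t\ge 0$, $\eta_0=1$, $\sigma_0=0$, and $\beta_t:=\dot\eta_t/\eta_t$ and $\xi_t:=\eta_t^2\dot\sigma_t\sigma_t$ extend from $(0,T]$ to $C^\infty$ functions on $[0,T]$; values of $\dot\eta/\eta$ and of $\sigma\dot\sigma$ at $0$ are understood as continuous extensions. For data $p_{\mathrm{data}}$ on $\mathbb R^d$, let $p_t$ be the law of $\eta_tX_0+\eta_t\sigma_tZ$ with $X_0\sim p_{\mathrm{data}}$ and $Z\sim\mathcal N(0,\mathrm{Id})$ independent, let $$v_t(x)=-\beta_{T-t}\,x+(1+\alpha)\,\xi_{T-t}\,\nabla\log p_{T-t}(x),\qquad a_t=\alpha\,\xi_{T-t},$$ and, for $K\ge1$, $\gamma=T/K$, $t_k=k\gamma$, let $\hat Y$ be the Euler–Maruyama sampler $$\hat Y_0\sim p_T,\qquad \hat Y_{k+1}=\hat Y_k+\gamma\, v_{t_k}(\hat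 Y_k)+\sqrt{2\gamma a_{t_k}}\,\hat W_k,\qquad 0\le k<K,$$ with $\hat W_k\sim\mathcal N(0,\mathrm{Id})$ independent of each other and of $\hat Y_0$. For $\lambda>0$ put $$A_s=\frac{\dot\eta_s}{\eta_s},\quad B_s(\lambda)=\frac{\sigma_s\dot\sigma_s}{\lambda+\sigma_s^2},\quad N_s(\lambda)=\frac{\lambda}{\lambda+\sigma_s^2},\quad Q_s(\lambda)=A_s+(1+\alpha)B_s(\lambda).$$ **Proposition.** (1) Let $(\eta,\sigma)$ be regular with $\sigma_t\dot\sigma_t\ge0$ on $(0,T]$. There are functions $\Delta^\mu,\Delta^\Sigma$ of $\lambda>0$ and of the number of steps $K$, depending otherwise only on $T,\alpha,\eta,\sigma$, such that for all Gaussian data $p_{\mathrm{data}}=\mathcal N(\mu_{\mathrm{data}},\Sigma_{\mathrm{data}})$ on any $\mathbb R^d$ with $\Sigma_{\mathrm{data}}=U\operatorname{Diag}(\lambda_i)U^\top$, $U$ orthogonal, all $\lambda_i>0$, and all $K\ge1$, $\hat Y_K$ is square integrable and $$\mathbb E[\hat Y_K]=\mu_{\mathrm{data}}+U\operatorname{Diag}\big(\Delta^\mu(\lambda_i)\big)U^\top\mu_{\mathrm{data}},\qquad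 \operatorname{Cov}[\hat Y_K]=\Sigma_{\mathrm{data}}+U\operatorname{Diag}\big(\Delta^\Sigma(\lambda_i)\big)U^\top.$$ For every $\lambda>0$, as $K\to\infty$ with $T$ fixed, both defects satisfy $$\Delta(\lambda)=\gamma\Delta^{[1]}(\lambda)+\gamma^2\Delta^{[2]}(\lambda)+O(\gamma^3),$$ with first-order coefficients $$\Delta^{\mu,[1]}(\lambda)=-\tfrac12\int_0^T N_s(\lambda)^{\frac{1+\alpha}2}A_s\big(A_s+(1+\alpha)B_s(\lambda)\big)\,ds-\tfrac12\Big[N_s(\lambda)^{\frac{1+\alpha}2}A_s\Big]_0^T,$$ $$\Delta^{\Sigma,[1]}(\lambda)=-\lambda\int_0^T N_s(\lambda)^{\alpha}\Big[\big(A_s+B_s(\lambda)\big)^2-\alpha^2B_s(\lambda)^2\Big]ds-\Big[\lambda N_s(\lambda)^\alpha\big(A_s+B_s(\lambda)\big)\Big]_0^T,$$ and second-order coefficients (all of $A,B,N,Q$ taken at $s$ and $\lambda$) $$\Delta^{\mu,[2]}(\lambda)=\int_0^T\Big\{-\tfrac12\big(\dot Q+Q^2\big)\tilde\Delta^{\mu,[1]}_s(\lambda)+N^{\frac{1+\alpha}2}\Big[-\tfrac14Q\big(\dot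 A+A^2\big)-\tfrac1{12}\big(\ddot A+3A\dot A+A^3\big)\Big]\Big\}ds,$$ $$\begin{aligned}\Delta^{\Sigma,[2]}(\lambda)=\int_0^T\Big\{&-\big(\dot Q+Q^2\big)\tilde\Delta^{\Sigma,[1]}_s(\lambda)+\lambda N^\alpha\Big[-\tfrac16\big(\ddot A+\ddot B+6(A+B)(\dot A+\dot B)+4(A+B)^3\big)\\&-Q\big(\dot A+\dot B+2(A+B)^2\big)+Q\dot Q+2Q^3-\alpha BQ^2\Big]\Big\}ds,\end{aligned}$$ where $$\tilde\Delta^{\mu,[1]}_s(\lambda)=-\tfrac12\int_s^TN_u^{\frac{1+\alpha}2}\big(\dot A_u+A_u^2\big)du,\qquad \tilde\Delta^{\Sigma,[1]}_s(\lambda)=-\lambda\int_s^TN_u^\alpha\big(\dot A_u+\dot B_u+2(A_u+B_u)^2-Q_u^2\big)du.$$ (2) Keep $T$ and $\alpha$ fixed and consider a family of regular schedules with $\beta_0=0$ and $\xi_0=0$ such that, along the family, $\sigma_T=\sigma_{\max}\to\infty$ and $$\sigma_T^{-(1+\alpha)}\frac{\dot\eta_T}{\eta_T}\to0,\qquad \sigma_T^{-2\alpha}\Big(\frac{\dot\eta_T}{\eta_T}+\frac{\dot\sigma_T}{\sigma_T}\Big)\to0.$$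 Then for every $\lambda>0$ the boundary terms $-\tfrac12\big[N_s(\lambda)^{\frac{1+\alpha}2}A_s\big]_0^T$ and $-\big[\lambda N_s(\lambda)^\alpha(A_s+B_s(\lambda))\big]_0^T$ tend to $0$. -/

import Mathlib

open MeasureTheory ProbabilityTheory Filter Topology Set
open scoped ContDiff Matrix Gradient

universe u v

noncomputable section

namespace DiffusionEM

/-! ### Schedules on a fixed horizon `[0, T]` -/

/-- The time derivative on `(0, T]` (one-sided at the right endpoint `T`). -/
def dot (T : ℝ) (f : ℝ → ℝ) (t : ℝ) : ℝ := derivWithin f (Ioc 0 T) t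

/-- `β_t = A_t = η̇_t / η_t` for `0 < t ≤ T`, extended to `t = 0` by continuity. -/
def rescalingRate (T : ℝ) (η : ℝ → ℝ) : ℝ → ℝ :=
  extendFrom (Ioc 0 T) (fun t => dot T η t / η t)

/-- `σ_t σ̇_t` for `0 < t ≤ T`, extended to `t = 0` by continuity
(the function `σ` itself need not be differentiable at `0`, e.g. `σ_t = √t`). -/
def noiseRate (T : ℝ) (σ : ℝ → ℝ) : ℝ → ℝ :=
  extendFrom (Ioc 0 T) (fun t => σ t * dot T σ t)

/-- `ξ_t = η_t² σ̇_t σ_t`. -/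
def diffusionRate (T : ℝ) (η σ : ℝ → ℝ) (t : ℝ) : ℝ :=
  η t ^ 2 * noiseRate T σ t

/-- The standing regularity assumption on the schedules `(η, σ)`. -/
structure RegularSchedule (T : ℝ) (η σ : ℝ → ℝ) : Prop where
  eta_continuousOn : ContinuousOn η (Icc 0 T)
  sigma_continuousOn : ContinuousOn σ (Icc 0 T)
  eta_contDiffOn : ContDiffOn ℝ ∞ η (Ioc 0 T)
  sigma_contDiffOn : ContDiffOn ℝ ∞ σ (Ioc 0 T)
  eta_pos : ∀ t ∈ Icc 0 T, 0 < η t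
  sigma_nonneg : ∀ t ∈ Icc 0 T, 0 ≤ σ t
  eta_zero : η 0 = 1
  sigma_zero : σ 0 = 0
  rescalingRate_contDiffOn : ContDiffOn ℝ ∞ (rescalingRate T η) (Icc 0 T)
  diffusionRate_contDiffOn : ContDiffOn ℝ ∞ (diffusionRate T η σ) (Icc 0 T)

/-- The optional assumption on a family of schedules `(η_i, σ_i)` on the same horizon `[0, T]`,
along a filter `l` on which the terminal noise level `σ_i(T)` tends to infinity. -/
structure LargeTerminalNoise (T α : ℝ) {ι : Type v} (l : Filter ι) (η σ : ι → ℝ → ℝ) : Prop where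
  rescalingRate_zero : ∀ i, rescalingRate T (η i) 0 = 0
  diffusionRate_zero : ∀ i, diffusionRate T (η i) (σ i) 0 = 0
  tendsto_sigma : Tendsto (fun i => σ i T) l atTop
  tendsto_rescaling :
    Tendsto (fun i => σ i T ^ (-(1 + α)) * (dot T (η i) T / η i T)) l (𝓝 0)
  tendsto_noise :
    Tendsto (fun i => σ i T ^ (-(2 * α)) * (dot T (η i) T / η i T + dot T (σ i) T / σ i T))
      l (𝓝 0)

/-! ### Forward marginals, score, reverse-time coefficients -/

section Sampler

variable {d : ℕ}

/-- The marginal law `p_t` of the forward process: the law of `η_t X₀ + η_t σ_t Z`, where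
`X₀ ∼ p_data` and `Z ∼ N(0, Id)` are independent. -/
def forwardMarginal (pdata : Measure (EuclideanSpace ℝ (Fin d))) (η σ : ℝ → ℝ) (t : ℝ) :
    Measure (EuclideanSpace ℝ (Fin d)) :=
  (pdata.map (fun x => η t • x)).conv
    ((stdGaussian (EuclideanSpace ℝ (Fin d))).map (fun z => (η t * σ t) • z))

/-- `f` is a continuous (nonnegative) Lebesgue density of `m`; such an `f` is unique. -/
def IsContinuousDensity (m : Measure (EuclideanSpace ℝ (Fin d)))
    (f : EuclideanSpace ℝ (Fin d) → ℝ) : Prop :=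
  Continuous f ∧ (∀ x, 0 ≤ f x) ∧ m = volume.withDensity (fun x => ENNReal.ofReal (f x))

open Classical in
/-- The continuous Lebesgue density of `m` (zero if there is none). -/
def continuousDensity (m : Measure (EuclideanSpace ℝ (Fin d))) :
    EuclideanSpace ℝ (Fin d) → ℝ :=
  if h : ∃ f, IsContinuousDensity m f then h.choose else 0

/-- The score `∇ log m` of a law `m` with a continuous density. -/
def score (m : Measure (EuclideanSpace ℝ (Fin d))) (x : EuclideanSpace ℝ (Fin d)) :
    EuclideanSpace ℝ (Fin d) :=
  ∇ (fun y => Real.log (continuousDensity m y)) x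

/-- The drift of the reverse-time SDE,
`v_t(x) = - β_{T-t} x + (1 + α) ξ_{T-t} ∇ log p_{T-t}(x)`. -/
def reverseDrift (T α : ℝ) (η σ : ℝ → ℝ) (pdata : Measure (EuclideanSpace ℝ (Fin d)))
    (t : ℝ) (x : EuclideanSpace ℝ (Fin d)) : EuclideanSpace ℝ (Fin d) :=
  -(rescalingRate T η (T - t) • x)
    + ((1 + α) * diffusionRate T η σ (T - t)) • score (forwardMarginal pdata η σ (T - t)) x

/-- The diffusion coefficient of the reverse-time SDE, `a_t = α ξ_{T-t}`. -/
def reverseDiffusion (T α : ℝ) (η σ : ℝ → ℝ) (t : ℝ) : ℝ :=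
  α * diffusionRate T η σ (T - t)

/-- `Y` is the Euler–Maruyama discretization, with `K` steps of size `γ = T / K`, of
`dY = v_t(Y) dt + √(2 a_t) dW`, started from the law `q₀` and driven by the i.i.d. standard Gaussian
vectors `W 0, …, W (K - 1)`, independent of `Y 0`. -/
structure IsEulerMaruyama {Ω : Type u} [MeasurableSpace Ω] (P : Measure Ω) (T : ℝ) (K : ℕ)
    (v : ℝ → EuclideanSpace ℝ (Fin d) → EuclideanSpace ℝ (Fin d)) (a : ℝ → ℝ)
    (q₀ : Measure (EuclideanSpace ℝ (Fin d)))
    (W : Fin K → Ω → EuclideanSpace ℝ (Fin d))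
    (Y : ℕ → Ω → EuclideanSpace ℝ (Fin d)) : Prop where
  measurable_init : Measurable (Y 0)
  law_init : P.map (Y 0) = q₀
  measurable_noise : ∀ k, Measurable (W k)
  law_noise : ∀ k, P.map (W k) = stdGaussian (EuclideanSpace ℝ (Fin d))
  indep_noise : iIndepFun W P
  indep_init : IndepFun (Y 0) (fun o k => W k o) P
  step : ∀ (k : Fin K) (o : Ω),
    Y (k + 1) o = Y k o + (T / K) • v (T / K * k) (Y k o)
      + √(2 * (T / K) * a (T / K * k)) • W k o

/-- The covariance matrix of a random vector. -/
def covMatrix {Ω : Type u} [MeasurableSpace Ω] (P : Measure Ω)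
    (X : Ω → EuclideanSpace ℝ (Fin d)) : Matrix (Fin d) (Fin d) ℝ :=
  Matrix.of fun i j => cov[fun o => X o i, fun o => X o j; P]

end Sampler

/-! ### The coefficients of the expansions, in an eigendirection of variance `lam` -/

/-- `B_s(λ) = σ_s σ̇_s / (λ + σ_s²)`. -/
def coeffB (T : ℝ) (σ : ℝ → ℝ) (lam s : ℝ) : ℝ := noiseRate T σ s / (lam + σ s ^ 2)

/-- `N_s(λ) = λ / (λ + σ_s²)`. -/
def coeffN (σ : ℝ → ℝ) (lam s : ℝ) : ℝ := lam / (lam + σ s ^ 2)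

/-- `Q_s(λ) = A_s + (1 + α) B_s(λ)`. -/
def coeffQ (T α : ℝ) (η σ : ℝ → ℝ) (lam s : ℝ) : ℝ :=
  rescalingRate T η s + (1 + α) * coeffB T σ lam s

/-- First time derivative on the closed interval `[0, T]`. -/
def D1 (T : ℝ) (f : ℝ → ℝ) (s : ℝ) : ℝ := derivWithin f (Icc 0 T) s

/-- Second time derivative on the closed interval `[0, T]`. -/
def D2 (T : ℝ) (f : ℝ → ℝ) (s : ℝ) : ℝ := D1 T (D1 T f) s

/-- The boundary term `- ½ [N_s^{(1+α)/2} A_s]_0^T`. -/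
def meanBoundary (T α : ℝ) (η σ : ℝ → ℝ) (lam : ℝ) : ℝ :=
  -(1 / 2) * (coeffN σ lam T ^ ((1 + α) / 2) * rescalingRate T η T
    - coeffN σ lam 0 ^ ((1 + α) / 2) * rescalingRate T η 0)

/-- The boundary term `- [λ N_s^α (A_s + B_s)]_0^T`. -/
def covBoundary (T α : ℝ) (η σ : ℝ → ℝ) (lam : ℝ) : ℝ :=
  -(lam * coeffN σ lam T ^ α * (rescalingRate T η T + coeffB T σ lam T)
    - lam * coeffN σ lam 0 ^ α * (rescalingRate T η 0 + coeffB T σ lam 0))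

/-- `Δ^{μ,[1]}(λ)`. -/
def meanCoeff1 (T α : ℝ) (η σ : ℝ → ℝ) (lam : ℝ) : ℝ :=
  -(1 / 2) * (∫ s in (0 : ℝ)..T, coeffN σ lam s ^ ((1 + α) / 2) * rescalingRate T η s
      * (rescalingRate T η s + (1 + α) * coeffB T σ lam s))
    + meanBoundary T α η σ lam

/-- `Δ^{Σ,[1]}(λ)`. -/
def covCoeff1 (T α : ℝ) (η σ : ℝ → ℝ) (lam : ℝ) : ℝ :=
  -lam * (∫ s in (0 : ℝ)..T, coeffN σ lam s ^ α
      * ((rescalingRate T η s + coeffB T σ lam s) ^ 2 - α ^ 2 * coeffB T σ lam s ^ 2))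
    + covBoundary T α η σ lam

/-- `Δ̃_s^{μ,[1]}(λ) = - ½ ∫_s^T N_u^{(1+α)/2} (Ȧ_u + A_u²) du`. -/
def meanTail1 (T α : ℝ) (η σ : ℝ → ℝ) (lam s : ℝ) : ℝ :=
  -(1 / 2) * ∫ w in s..T, coeffN σ lam w ^ ((1 + α) / 2)
      * (D1 T (rescalingRate T η) w + rescalingRate T η w ^ 2)

/-- `Δ̃_s^{Σ,[1]}(λ) = - λ ∫_s^T N_u^α (Ȧ_u + Ḃ_u + 2 (A_u + B_u)² - Q_u²) du`. -/
def covTail1 (T α : ℝ) (η σ : ℝ → ℝ) (lam s : ℝ) : ℝ :=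
  -lam * ∫ w in s..T, coeffN σ lam w ^ α
      * (D1 T (rescalingRate T η) w + D1 T (coeffB T σ lam) w
        + 2 * (rescalingRate T η w + coeffB T σ lam w) ^ 2 - coeffQ T α η σ lam w ^ 2)

/-- `Δ^{μ,[2]}(λ)`. The factor `N_s^{(1+α)/2}` multiplies only the last two groups of terms: it is
the propagator applied to the exact mean, and it is already contained in `Δ̃_s^{μ,[1]}(λ)`. -/
def meanCoeff2 (T α : ℝ) (η σ : ℝ → ℝ) (lam : ℝ) : ℝ :=
  ∫ s in (0 : ℝ)..T,
    (-(1 / 2) * (D1 T (coeffQ T α η σ lam) s + coeffQ T α η σ lam s ^ 2)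
        * meanTail1 T α η σ lam s
      + coeffN σ lam s ^ ((1 + α) / 2)
        * (-(1 / 4) * coeffQ T α η σ lam s
            * (D1 T (rescalingRate T η) s + rescalingRate T η s ^ 2)
          - (1 / 12) * (D2 T (rescalingRate T η) s
            + 3 * rescalingRate T η s * D1 T (rescalingRate T η) s + rescalingRate T η s ^ 3)))

/-- `Δ^{Σ,[2]}(λ)`. -/
def covCoeff2 (T α : ℝ) (η σ : ℝ → ℝ) (lam : ℝ) : ℝ :=
  ∫ s in (0 : ℝ)..T,
    (-(D1 T (coeffQ T α η σ lam) s + coeffQ T α η σ lam s ^ 2) * covTail1 T α η σ lam s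
      + lam * coeffN σ lam s ^ α
        * (-(1 / 6) * (D2 T (rescalingRate T η) s + D2 T (coeffB T σ lam) s
              + 6 * (rescalingRate T η s + coeffB T σ lam s)
                * (D1 T (rescalingRate T η) s + D1 T (coeffB T σ lam) s)
              + 4 * (rescalingRate T η s + coeffB T σ lam s) ^ 3)
          - coeffQ T α η σ lam s
            * (D1 T (rescalingRate T η) s + D1 T (coeffB T σ lam) s
              + 2 * (rescalingRate T η s + coeffB T σ lam s) ^ 2)
          + coeffQ T α η σ lam s * D1 T (coeffQ T α η σ lam) s
          + 2 * coeffQ T α η σ lam s ^ 3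
          - α * coeffB T σ lam s * coeffQ T α η σ lam s ^ 2))

end DiffusionEM

end

open DiffusionEM

/-!
Passing to reversed noise time `s = T - t`, everything reduces to a statement about one scalar
one-step scheme.

*Decoupling.* For Gaussian data with covariance `U Diag(λ) Uᵀ`, the columns `b` of `U` are an
eigenbasis of every forward marginal: it is the image of the standard Gaussian law under
`z ↦ η μ + L z`, where `L` is diagonal in `b` with entries `η √(λ i + σ²)`
(`forwardMarginal_eq_basisGaussian`, by characteristic functions). Its explicit density gives the
score (`inner_score_basisGaussian`), and so the `i`-th coordinate of the drift is an affine function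
of the `i`-th coordinate of the state (`inner_reverseDrift`). Therefore the coordinates of the
Euler–Maruyama iterates remain uncorrelated, their means satisfy `m ↦ (1 - γ Q) m + γ (1 + α) B η`
(times the data mean), and their variances satisfy `c ↦ (1 - γ Q)² c + 2 γ α ξ`
(`moments_eulerMaruyama`).

*Expansion.* Both recursions have the form `u ↦ (1 + γ p + γ² r) u + γ g`, a discretization of the
backward equation `-y' = p y + g`, which is solved by `y = η` and by `y = η² (λ + σ²)` respectively.
Insert `y + γ e₁ + γ² e₂` into the scheme and compare powers of `γ`: the correctors solve linear
equations with the same homogeneous part, and with these the residual of one step is `O(γ⁴)`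
(`exists_local_error_bound`), so that the discrete Grönwall inequality gives a global error
`O(γ³)` (`schemeSeq_sub_isBigO`). Variation of constants with the propagator `Φ`, `Φ' = p Φ`,
expresses `e₁` and `e₂` at `s = 0` as integrals (`schemeSeq_expansion`). Here `Φ` is
`N ^ ((1 + α) / 2) / η` for the mean and `N ^ (1 + α) / η²` for the variance, so that `Φ y` is
`N ^ ((1 + α) / 2)` and `λ N ^ α`; the boundary terms in the first-order coefficients come from an
integration by parts against these powers of `N` (`integral_coeffN_rpow_mul_D1`).

*Boundary terms.* At time `0` they vanish by assumption. At time `T`, `N ≤ λ σ⁻²` turns powers of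
`N` into the weights of the two growth hypotheses, and
`A + B = (A + σ̇ / σ) - N ((A + σ̇ / σ) - A)`.
-/

open DiffusionEM

/-! ### Calculus on a compact interval -/

section Calculus

variable {T : ℝ} {f f' : ℝ → ℝ}

theorem ContDiffOn.hasDerivWithinAt_D1 (hf : ContDiffOn ℝ ∞ f (Icc 0 T)) {s : ℝ}
    (hs : s ∈ Icc 0 T) : HasDerivWithinAt f (D1 T f s) (Icc 0 T) s :=
  ((hf.differentiableOn (by simp)) s hs).hasDerivWithinAt

theorem HasDerivWithinAt.D1_eq (hT : 0 < T) {s a : ℝ} (hs : s ∈ Icc 0 T)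
    (h : HasDerivWithinAt f a (Icc 0 T) s) : D1 T f s = a :=
  h.derivWithin (uniqueDiffOn_Icc hT s hs)

theorem ContDiffOn.D1 (hT : 0 < T) (hf : ContDiffOn ℝ ∞ f (Icc 0 T)) :
    ContDiffOn ℝ ∞ (D1 T f) (Icc 0 T) :=
  ((contDiffOn_infty_iff_derivWithin (uniqueDiffOn_Icc hT)).1 hf).2

theorem contDiffOn_infty_of_hasDerivWithinAt (hT : 0 < T)
    (h : ∀ s ∈ Icc 0 T, HasDerivWithinAt f (f' s) (Icc 0 T) s)
    (hf' : ContDiffOn ℝ ∞ f' (Icc 0 T)) : ContDiffOn ℝ ∞ f (Icc 0 T) := by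
  refine (contDiffOn_infty_iff_derivWithin (uniqueDiffOn_Icc hT)).2
    ⟨fun s hs => (h s hs).differentiableWithinAt, hf'.congr fun s hs => ?_⟩
  exact (h s hs).D1_eq hT hs

theorem exists_abs_le_of_contDiffOn (hf : ContDiffOn ℝ ∞ f (Icc 0 T)) :
    ∃ M, 0 ≤ M ∧ ∀ s ∈ Icc 0 T, |f s| ≤ M := by
  obtain ⟨M, hM⟩ := isCompact_Icc.exists_bound_of_continuousOn hf.continuousOn
  exact ⟨max M 0, le_max_right _ _, fun s hs => (hM s hs).trans (le_max_left _ _)⟩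

/-- Taylor's formula with a remainder that is uniform in the base point. Unlike the versions based
at an endpoint, it also covers steps to the left. -/
theorem exists_taylor_bound (hT : 0 < T) (n : ℕ) : ∀ f : ℝ → ℝ, ContDiffOn ℝ ∞ f (Icc 0 T) →
    ∃ M, 0 ≤ M ∧ ∀ s ∈ Icc 0 T, ∀ x ∈ Icc 0 T,
      |f x - ∑ j ∈ Finset.range n, (D1 T)^[j] f s * (x - s) ^ j / (j.factorial : ℝ)|
        ≤ M * |x - s| ^ n := by
  induction n with
  | zero =>
    intro f hf
    obtain ⟨M, hM0, hM⟩ := exists_abs_le_of_contDiffOn hf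
    exact ⟨M, hM0, fun s _ x hx => by simpa using hM x hx⟩
  | succ n ih =>
    intro f hf
    obtain ⟨M, hM0, hM⟩ := ih _ (hf.D1 hT)
    refine ⟨M, hM0, fun s hs x hx => ?_⟩
    set R : ℝ → ℝ := fun w =>
      f w - ∑ j ∈ Finset.range (n + 1), (D1 T)^[j] f s * (w - s) ^ j / (j.factorial : ℝ) with hR
    have hsub : uIcc s x ⊆ Icc 0 T := uIcc_subset_Icc hs hx
    have hderiv : ∀ w ∈ uIcc s x, HasDerivWithinAt R (D1 T f w - ∑ j ∈ Finset.range n,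
        (D1 T)^[j] (D1 T f) s * (w - s) ^ j / (j.factorial : ℝ)) (uIcc s x) w := by
      intro w hw
      refine ((hf.hasDerivWithinAt_D1 (hsub hw)).mono hsub).sub ?_
      have hpoly : ∀ j : ℕ, HasDerivAt
          (fun w : ℝ => (D1 T)^[j + 1] f s * (w - s) ^ (j + 1) / ((j + 1).factorial : ℝ))
          ((D1 T)^[j] (D1 T f) s * (w - s) ^ j / (j.factorial : ℝ)) w := by
        intro j
        have h1 := ((((hasDerivAt_id w).sub_const s).pow (j + 1)).const_mul
          ((D1 T)^[j + 1] f s)).div_const ((j + 1).factorial : ℝ)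
        refine h1.congr_deriv ?_
        rw [Nat.factorial_succ]
        have : (j.factorial : ℝ) ≠ 0 := by positivity
        push_cast
        simp only [Function.iterate_succ, Function.comp_apply, id_eq]
        field_simp
      simp_rw [Finset.sum_range_succ' _ n]
      simpa using ((HasDerivAt.fun_sum fun j _ => hpoly j).add_const
        ((D1 T)^[0] f s * 1 / 1)).hasDerivWithinAt
    have hbound : ∀ w ∈ uIcc s x, ‖D1 T f w - ∑ j ∈ Finset.range n,
        (D1 T)^[j] (D1 T f) s * (w - s) ^ j / (j.factorial : ℝ)‖ ≤ M * |x - s| ^ n := by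
      intro w hw
      refine (hM s hs w (hsub hw)).trans ?_
      exact mul_le_mul_of_nonneg_left
        (pow_le_pow_left₀ (abs_nonneg _) (abs_sub_left_of_mem_uIcc hw) n) hM0
    have := (convex_uIcc s x).norm_image_sub_le_of_norm_hasDerivWithin_le hderiv hbound
      left_mem_uIcc right_mem_uIcc
    have hRs : R s = 0 := by
      simp only [hR]
      rw [Finset.sum_range_succ']
      simp
    rw [hRs, sub_zero, Real.norm_eq_abs, Real.norm_eq_abs, mul_assoc, ← pow_succ] at this
    exact this

/-- Differentiability at the left endpoint follows from that on `(0, T]` when the derivative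
extends continuously. -/
theorem hasDerivWithinAt_Icc_of_Ioc (hT : 0 < T) (hf : ContinuousOn f (Icc 0 T))
    (h : ∀ s ∈ Ioc 0 T, HasDerivWithinAt f (f' s) (Ioc 0 T) s)
    (hf' : ContinuousOn f' (Icc 0 T)) {s : ℝ} (hs : s ∈ Icc 0 T) :
    HasDerivWithinAt f (f' s) (Icc 0 T) s := by
  rcases hs.1.eq_or_lt with rfl | h0
  · have hda : ∀ t ∈ Ioo 0 T, HasDerivAt f (f' t) t := fun t ht =>
      (h t ⟨ht.1, ht.2.le⟩).hasDerivAt (Ioc_mem_nhds ht.1 ht.2)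
    have hmem : Ioo 0 T ∈ 𝓝[>] (0 : ℝ) := Ioo_mem_nhdsGT hT
    refine (hasDerivWithinAt_Ici_of_tendsto_deriv (s := Ioo 0 T)
      (fun t ht => (hda t ht).differentiableAt.differentiableWithinAt)
      ((hf 0 hs).mono Ioo_subset_Icc_self) hmem ?_).mono Icc_subset_Ici_self
    refine Tendsto.congr' (f₁ := f') ?_ ?_
    · filter_upwards [hmem] with t ht using (hda t ht).deriv.symm
    · have := (hf' 0 hs).mono Ioo_subset_Icc_self
      rwa [ContinuousWithinAt, nhdsWithin_Ioo_eq_nhdsGT hT] at this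
  · refine (h s ⟨h0, hs.2⟩).mono_of_mem_nhdsWithin ?_
    filter_upwards [self_mem_nhdsWithin, mem_nhdsWithin_of_mem_nhds (lt_mem_nhds h0)] with t h1 h2
      using ⟨h2, h1.2⟩

/-- The fundamental theorem of calculus for the lower limit, up to both endpoints. -/
theorem hasDerivWithinAt_integral_tail (hf : ContinuousOn f (Icc 0 T)) {s : ℝ}
    (hs : s ∈ Icc 0 T) :
    HasDerivWithinAt (fun t => ∫ w in t..T, f w) (-f s) (Icc 0 T) s := by
  have hT : (0 : ℝ) ≤ T := hs.1.trans hs.2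
  set F : ℝ → ℝ := IccExtend hT ((Icc 0 T).domRestrict f) with hF
  have hFc : Continuous F := (continuousOn_iff_continuous_domRestrict.1 hf).Icc_extend'
  have hFf : ∀ t ∈ Icc 0 T, F t = f t := fun t ht => by
    rw [hF, IccExtend_of_mem hT _ ht, domRestrict_apply]
  have key : HasDerivAt (fun t => ∫ w in t..T, F w) (-F s) s :=
    intervalIntegral.integral_hasDerivAt_left (hFc.intervalIntegrable _ _)
      hFc.stronglyMeasurable.stronglyMeasurableAtFilter hFc.continuousAt
  rw [← hFf s hs]
  refine key.hasDerivWithinAt.congr_of_mem (fun t ht => ?_) hs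
  refine intervalIntegral.integral_congr fun w hw => (hFf w ?_).symm
  exact uIcc_subset_Icc ht ⟨hT, le_rfl⟩ hw

end Calculus

/-! ### Second-order error expansion of a scalar one-step scheme -/

section Scheme

/-- The scalar scheme `u_{k+1} = (1 + γ p + γ² r) u_k + γ g` with `γ = T / K`, run backwards in
time: the coefficients of step `k` are taken at `T - γ k`. -/
noncomputable def schemeSeq (T : ℝ) (p r g : ℝ → ℝ) (u₀ : ℝ) (K : ℕ) : ℕ → ℝ
  | 0 => u₀
  | k + 1 => (1 + T / K * p (T - T / K * k) + (T / K) ^ 2 * r (T - T / K * k))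
      * schemeSeq T p r g u₀ K k + T / K * g (T - T / K * k)

/-- A discrete Grönwall inequality. -/
theorem abs_le_of_step_le {δ : ℕ → ℝ} {K : ℕ} {a c : ℝ} (ha : 0 ≤ a) (hc : 0 ≤ c) (h0 : δ 0 = 0)
    (h : ∀ k < K, |δ (k + 1)| ≤ (1 + a) * |δ k| + c) :
    ∀ k ≤ K, |δ k| ≤ k * c * Real.exp (a * k) := by
  intro k
  induction k with
  | zero => intro _; simp [h0]
  | succ k ih =>
    intro hk
    have h1 := h k (by omega)
    have h2 := ih (by omega)
    have hexp : (1 + a) * Real.exp (a * k) ≤ Real.exp (a * (k + 1)) := by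
      rw [mul_add, Real.exp_add, mul_one, mul_comm]
      have := Real.add_one_le_exp a
      gcongr
      linarith
    have hone : 1 ≤ Real.exp (a * (k + 1)) := Real.one_le_exp (by positivity)
    push_cast
    calc |δ (k + 1)| ≤ (1 + a) * (k * c * Real.exp (a * k)) + c := by
          refine h1.trans ?_
          gcongr
      _ = k * c * ((1 + a) * Real.exp (a * k)) + c * 1 := by ring
      _ ≤ k * c * Real.exp (a * (k + 1)) + c * Real.exp (a * (k + 1)) := by gcongr
      _ = _ := by ring

variable {T : ℝ} {p r g y e₁ e₂ Φ : ℝ → ℝ}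

/-- The truncated expansion `y + γ e₁ + γ² e₂` solves the scheme up to an error of order `γ⁴`
as soon as `y`, `e₁`, `e₂` solve the limiting equation and its first two corrector equations. -/
theorem exists_local_error_bound (hT : 0 < T) (hr : ContDiffOn ℝ ∞ r (Icc 0 T))
    (hy : ContDiffOn ℝ ∞ y (Icc 0 T)) (he₁ : ContDiffOn ℝ ∞ e₁ (Icc 0 T))
    (he₂ : ContDiffOn ℝ ∞ e₂ (Icc 0 T))
    (Hy : ∀ s ∈ Icc 0 T, D1 T y s = -(p s * y s + g s))
    (He₁ : ∀ s ∈ Icc 0 T, D1 T e₁ s = -(p s * e₁ s + (r s * y s - D2 T y s / 2)))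
    (He₂ : ∀ s ∈ Icc 0 T, D1 T e₂ s
      = -(p s * e₂ s + (r s * e₁ s - D2 T e₁ s / 2 + D1 T (D2 T y) s / 6))) :
    ∃ M, 0 ≤ M ∧ ∀ γ s, 0 ≤ γ → s ∈ Icc 0 T → s - γ ∈ Icc 0 T →
      |(y (s - γ) + γ * e₁ (s - γ) + γ ^ 2 * e₂ (s - γ))
        - ((1 + γ * p s + γ ^ 2 * r s) * (y s + γ * e₁ s + γ ^ 2 * e₂ s) + γ * g s)|
        ≤ M * γ ^ 4 := by
  obtain ⟨M₀, hM₀, h₀⟩ := exists_taylor_bound hT 4 y hy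
  obtain ⟨M₁, hM₁, h₁⟩ := exists_taylor_bound hT 3 e₁ he₁
  obtain ⟨M₂, hM₂, h₂⟩ := exists_taylor_bound hT 2 e₂ he₂
  obtain ⟨M₃, hM₃, h₃⟩ := exists_abs_le_of_contDiffOn (hr.mul he₂)
  refine ⟨M₀ + M₁ + M₂ + M₃, by positivity, fun γ s hγ hs hsγ => ?_⟩
  have k₀ := h₀ s hs _ hsγ
  have k₁ := h₁ s hs _ hsγ
  have k₂ := h₂ s hs _ hsγ
  have k₃ := h₃ s hs
  have habs : |s - γ - s| = γ := by rw [sub_sub_cancel_left, abs_neg, abs_of_nonneg hγ]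
  rw [habs] at k₀ k₁ k₂
  simp only [Finset.sum_range_succ, Finset.sum_range_zero, Function.iterate_succ,
    Function.iterate_zero, Function.comp_apply, id_eq, Nat.factorial, sub_sub_cancel_left]
    at k₀ k₁ k₂
  have E₀ := Hy s hs
  have E₁ := He₁ s hs
  have E₂ := He₂ s hs
  simp only [D2] at E₁ E₂
  set R₀ := y (s - γ) - _ with hR₀
  set R₁ := e₁ (s - γ) - _ with hR₁
  set R₂ := e₂ (s - γ) - _ with hR₂
  have key : (y (s - γ) + γ * e₁ (s - γ) + γ ^ 2 * e₂ (s - γ))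
        - ((1 + γ * p s + γ ^ 2 * r s) * (y s + γ * e₁ s + γ ^ 2 * e₂ s) + γ * g s)
      = R₀ + γ * R₁ + γ ^ 2 * R₂ - γ ^ 4 * (r s * e₂ s) := by
    have hD : D1 T (D2 T y) s = D1 T (D1 T (D1 T y)) s := rfl
    rw [hR₀, hR₁, hR₂, E₂, E₁, E₀, hD]
    push_cast
    ring
  rw [key]
  calc |R₀ + γ * R₁ + γ ^ 2 * R₂ - γ ^ 4 * (r s * e₂ s)|
      ≤ |R₀| + |γ * R₁| + |γ ^ 2 * R₂| + |γ ^ 4 * (r s * e₂ s)| :=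
        (abs_sub _ _).trans (by gcongr; exact abs_add_three _ _ _)
    _ = |R₀| + γ * |R₁| + γ ^ 2 * |R₂| + γ ^ 4 * |r s * e₂ s| := by
        simp only [abs_mul, abs_pow, abs_of_nonneg hγ]
    _ ≤ M₀ * γ ^ 4 + γ * (M₁ * γ ^ 3) + γ ^ 2 * (M₂ * γ ^ 2) + γ ^ 4 * M₃ := by
        gcongr
    _ = _ := by ring

/-- From local errors of order `γ⁴` to a global error of order `γ³`. -/
theorem schemeSeq_sub_isBigO (hT : 0 < T) (hp : ContDiffOn ℝ ∞ p (Icc 0 T))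
    (hr : ContDiffOn ℝ ∞ r (Icc 0 T))
    (hy : ContDiffOn ℝ ∞ y (Icc 0 T)) (he₁ : ContDiffOn ℝ ∞ e₁ (Icc 0 T))
    (he₂ : ContDiffOn ℝ ∞ e₂ (Icc 0 T))
    (Hy : ∀ s ∈ Icc 0 T, D1 T y s = -(p s * y s + g s))
    (He₁ : ∀ s ∈ Icc 0 T, D1 T e₁ s = -(p s * e₁ s + (r s * y s - D2 T y s / 2)))
    (He₂ : ∀ s ∈ Icc 0 T, D1 T e₂ s
      = -(p s * e₂ s + (r s * e₁ s - D2 T e₁ s / 2 + D1 T (D2 T y) s / 6)))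
    (he₁T : e₁ T = 0) (he₂T : e₂ T = 0) :
    (fun K : ℕ => schemeSeq T p r g (y T) K K - y 0 - (T / K * e₁ 0 + (T / K) ^ 2 * e₂ 0))
      =O[atTop] (fun K : ℕ => (T / K) ^ 3) := by
  obtain ⟨M, hM, hloc⟩ := exists_local_error_bound hT hr hy he₁ he₂ Hy He₁ He₂
  obtain ⟨Lp, hLp, hpb⟩ := exists_abs_le_of_contDiffOn hp
  obtain ⟨Lr, hLr, hrb⟩ := exists_abs_le_of_contDiffOn hr
  set L := Lp + T * Lr with hL
  have hL0 : 0 ≤ L := by positivity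
  refine Asymptotics.IsBigO.of_bound (T * M * Real.exp (L * T)) ?_
  filter_upwards [eventually_gt_atTop 0] with K hK
  have hK' : (0 : ℝ) < K := by exact_mod_cast hK
  set γ := T / K with hγ
  have hγ0 : 0 < γ := by positivity
  have hγK : γ * K = T := by rw [hγ]; field_simp
  have hγT : γ ≤ T := by
    have : (1 : ℝ) ≤ K := by exact_mod_cast hK
    nlinarith
  have hmem : ∀ k ≤ K, T - γ * k ∈ Icc 0 T := by
    intro k hk
    have hk' : (k : ℝ) ≤ K := by exact_mod_cast hk
    constructor
    · nlinarith
    · have : 0 ≤ γ * k := by positivity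
      linarith
  set z : ℝ → ℝ := fun s => y s + γ * e₁ s + γ ^ 2 * e₂ s with hz
  set δ : ℕ → ℝ := fun k => schemeSeq T p r g (y T) K k - z (T - γ * k) with hδ
  have hδ0 : δ 0 = 0 := by simp [hδ, hz, schemeSeq, he₁T, he₂T]
  have hstep : ∀ k < K, |δ (k + 1)| ≤ (1 + L * γ) * |δ k| + M * γ ^ 4 := by
    intro k hk
    have hs := hmem k hk.le
    have hs' := hmem (k + 1) hk
    have heq : T - γ * (k + 1 : ℕ) = T - γ * k - γ := by push_cast; ring
    rw [heq] at hs'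
    set s := T - γ * k with hsdef
    have hl := hloc γ s hγ0.le hs hs'
    have hsplit : δ (k + 1) = (1 + γ * p s + γ ^ 2 * r s) * δ k
        - (z (s - γ) - ((1 + γ * p s + γ ^ 2 * r s) * z s + γ * g s)) := by
      simp only [hδ, schemeSeq, heq]
      rw [← hγ, ← hsdef]
      ring
    rw [hsplit]
    refine (abs_sub _ _).trans (add_le_add ?_ hl)
    rw [abs_mul]
    refine mul_le_mul_of_nonneg_right ?_ (abs_nonneg _)
    refine (abs_add_three _ _ _).trans ?_
    rw [abs_mul, abs_mul, abs_of_pos hγ0, abs_one, abs_of_pos (pow_pos hγ0 2)]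
    have h1 := mul_le_mul_of_nonneg_left (hpb s hs) hγ0.le
    have h2 := mul_le_mul_of_nonneg_left (hrb s hs) (pow_pos hγ0 2).le
    have h3 : γ ^ 2 * Lr ≤ γ * (T * Lr) := by
      rw [pow_two, mul_assoc]
      gcongr
    rw [hL]
    linarith
  have hfin := abs_le_of_step_le (by positivity) (by positivity) hδ0 hstep K le_rfl
  have hTK : T - γ * K = 0 := by rw [hγK, sub_self]
  have hδK : schemeSeq T p r g (y T) K K - y 0 - (γ * e₁ 0 + γ ^ 2 * e₂ 0) = δ K := by
    simp only [hδ, hz, hTK]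
    ring
  rw [hδK, Real.norm_eq_abs, Real.norm_eq_abs, abs_of_pos (pow_pos hγ0 3)]
  refine hfin.trans (le_of_eq ?_)
  rw [mul_assoc L γ K, hγK, ← hγK]
  ring

/-- Variation of constants: `Φ⁻¹ ∫_s^T Φ h` solves the backward equation with right-hand side `h`
and terminal value `0`. -/
theorem D1_tail_div (hT : 0 < T) {h : ℝ → ℝ} (hΦ : ContDiffOn ℝ ∞ Φ (Icc 0 T))
    (hΦpos : ∀ s ∈ Icc 0 T, 0 < Φ s) (HΦ : ∀ s ∈ Icc 0 T, D1 T Φ s = p s * Φ s)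
    (hh : ContDiffOn ℝ ∞ h (Icc 0 T)) :
    ContDiffOn ℝ ∞ (fun s => (∫ w in s..T, Φ w * h w) / Φ s) (Icc 0 T) ∧
    ∀ s ∈ Icc 0 T, D1 T (fun s => (∫ w in s..T, Φ w * h w) / Φ s) s
      = -(p s * ((∫ w in s..T, Φ w * h w) / Φ s) + h s) := by
  have hΦh := hΦ.mul hh
  have htail := fun s hs => hasDerivWithinAt_integral_tail (T := T) hΦh.continuousOn (s := s) hs
  have hsm : ContDiffOn ℝ ∞ (fun s => ∫ w in s..T, Φ w * h w) (Icc 0 T) :=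
    contDiffOn_infty_of_hasDerivWithinAt hT htail hΦh.neg
  refine ⟨hsm.div hΦ fun s hs => (hΦpos s hs).ne', fun s hs => ?_⟩
  have hd := hΦ.hasDerivWithinAt_D1 hs
  rw [HΦ s hs] at hd
  have hne := (hΦpos s hs).ne'
  refine HasDerivWithinAt.D1_eq hT hs (((htail s hs).div hd hne).congr_deriv ?_)
  field_simp
  ring

/-- The error expansion of the scheme, with the two coefficients written as integrals against the
propagator `Φ`. -/
theorem schemeSeq_expansion (hT : 0 < T) (hp : ContDiffOn ℝ ∞ p (Icc 0 T))
    (hr : ContDiffOn ℝ ∞ r (Icc 0 T)) (hy : ContDiffOn ℝ ∞ y (Icc 0 T))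
    (hΦ : ContDiffOn ℝ ∞ Φ (Icc 0 T)) (hΦpos : ∀ s ∈ Icc 0 T, 0 < Φ s) (hΦ0 : Φ 0 = 1)
    (HΦ : ∀ s ∈ Icc 0 T, D1 T Φ s = p s * Φ s)
    (Hy : ∀ s ∈ Icc 0 T, D1 T y s = -(p s * y s + g s)) :
    (fun K : ℕ => schemeSeq T p r g (y T) K K - y 0
      - (T / K * (∫ s in (0 : ℝ)..T, Φ s * (r s * y s - D2 T y s / 2))
        + (T / K) ^ 2 * ∫ s in (0 : ℝ)..T,
          ((r s + (D1 T p s - p s ^ 2) / 2)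
              * (∫ w in s..T, Φ w * (r w * y w - D2 T y w / 2))
            + Φ s * ((D1 T r s * y s + r s * D1 T y s) / 2 - p s * r s * y s / 2
              + p s * D2 T y s / 4 - D1 T (D2 T y) s / 12))))
      =O[atTop] (fun K : ℕ => (T / K) ^ 3) := by
  have h0 : (0 : ℝ) ∈ Icc 0 T := ⟨le_rfl, hT.le⟩
  have hD2 : ∀ {f : ℝ → ℝ}, ContDiffOn ℝ ∞ f (Icc 0 T) → ContDiffOn ℝ ∞ (D2 T f) (Icc 0 T) :=
    fun hf => (hf.D1 hT).D1 hT
  set h₁ : ℝ → ℝ := fun s => r s * y s - D2 T y s / 2 with hh₁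
  have hh₁s : ContDiffOn ℝ ∞ h₁ (Icc 0 T) := (hr.mul hy).sub ((hD2 hy).div_const 2)
  obtain ⟨he₁, He₁⟩ := D1_tail_div hT hΦ hΦpos HΦ hh₁s
  set e₁ : ℝ → ℝ := fun s => (∫ w in s..T, Φ w * h₁ w) / Φ s with he₁d
  set h₂ : ℝ → ℝ := fun s => r s * e₁ s - D2 T e₁ s / 2 + D1 T (D2 T y) s / 6 with hh₂
  have hh₂s : ContDiffOn ℝ ∞ h₂ (Icc 0 T) :=
    ((hr.mul he₁).sub ((hD2 he₁).div_const 2)).add (((hD2 hy).D1 hT).div_const 6)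
  obtain ⟨he₂, He₂⟩ := D1_tail_div hT hΦ hΦpos HΦ hh₂s
  have main := schemeSeq_sub_isBigO hT hp hr hy he₁ he₂ Hy He₁ He₂ (by simp [he₁d]) (by simp)
  have hE₁ : e₁ 0 = ∫ s in (0 : ℝ)..T, Φ s * h₁ s := by simp [he₁d, hΦ0]
  have hD2e : ∀ s ∈ Icc 0 T, D2 T e₁ s = -(D1 T p s * e₁ s + p s * -(p s * e₁ s + h₁ s)
      + (D1 T r s * y s + r s * D1 T y s - D1 T (D2 T y) s / 2)) := by
    intro s hs
    have hd1 := he₁.hasDerivWithinAt_D1 hs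
    rw [He₁ s hs] at hd1
    have hd := (((hp.hasDerivWithinAt_D1 hs).mul hd1).add
      (((hr.hasDerivWithinAt_D1 hs).mul (hy.hasDerivWithinAt_D1 hs)).sub
        (((hD2 hy).hasDerivWithinAt_D1 hs).div_const 2))).neg
    exact HasDerivWithinAt.D1_eq hT hs (hd.congr (fun t ht => He₁ t ht) (He₁ s hs))
  have hE₂ : (∫ w in (0 : ℝ)..T, Φ w * h₂ w) / Φ 0 = ∫ s in (0 : ℝ)..T,
      ((r s + (D1 T p s - p s ^ 2) / 2) * (∫ w in s..T, Φ w * h₁ w)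
        + Φ s * ((D1 T r s * y s + r s * D1 T y s) / 2 - p s * r s * y s / 2
              + p s * D2 T y s / 4 - D1 T (D2 T y) s / 12)) := by
    rw [hΦ0, div_one]
    refine intervalIntegral.integral_congr fun s hs => ?_
    rw [uIcc_of_le hT.le] at hs
    have hte : (∫ w in s..T, Φ w * h₁ w) = Φ s * e₁ s := by
      have := (hΦpos s hs).ne'
      simp only [he₁d]
      field_simp
    simp only [hte, hh₂, hD2e s hs]
    simp only [hh₁]
    ring
  rw [← hE₂, ← hE₁]
  exact main

end Scheme

/-! ### Regularity of the schedules and of the coefficients -/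

section Schedule

variable {T : ℝ} {η σ : ℝ → ℝ}

namespace DiffusionEM.RegularSchedule

theorem continuousOn_dot {f : ℝ → ℝ} (hf : ContDiffOn ℝ ∞ f (Ioc 0 T)) :
    ContinuousOn (dot T f) (Ioc 0 T) :=
  hf.continuousOn_derivWithin (uniqueDiffOn_Ioc 0 T) (by simp)

theorem rescalingRate_eq (h : RegularSchedule T η σ) {t : ℝ} (ht : t ∈ Ioc 0 T) :
    rescalingRate T η t = dot T η t / η t :=
  extendFrom_extends ((continuousOn_dot h.eta_contDiffOn).div h.eta_contDiffOn.continuousOn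
    fun s hs => (h.eta_pos s (Ioc_subset_Icc_self hs)).ne') t ht

theorem noiseRate_eq (h : RegularSchedule T η σ) {t : ℝ} (ht : t ∈ Ioc 0 T) :
    noiseRate T σ t = σ t * dot T σ t :=
  extendFrom_extends (h.sigma_contDiffOn.continuousOn.mul
    (continuousOn_dot h.sigma_contDiffOn)) t ht

theorem hasDerivWithinAt_eta (h : RegularSchedule T η σ) (hT : 0 < T) {t : ℝ}
    (ht : t ∈ Icc 0 T) :
    HasDerivWithinAt η (rescalingRate T η t * η t) (Icc 0 T) t := by
  refine hasDerivWithinAt_Icc_of_Ioc (f' := fun s => rescalingRate T η s * η s) hT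
    h.eta_continuousOn (fun s hs => ?_)
    (h.rescalingRate_contDiffOn.continuousOn.mul h.eta_continuousOn) ht
  have hne := (h.eta_pos s (Ioc_subset_Icc_self hs)).ne'
  rw [h.rescalingRate_eq hs, div_mul_cancel₀ _ hne]
  exact (h.eta_contDiffOn.differentiableOn (by simp) s hs).hasDerivWithinAt

theorem contDiffOn_eta (h : RegularSchedule T η σ) (hT : 0 < T) :
    ContDiffOn ℝ ∞ η (Icc 0 T) := by
  -- bootstrap along the linear equation `η̇ = A η`
  have hU := uniqueDiffOn_Icc hT
  refine contDiffOn_infty.2 fun n => ?_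
  induction n with
  | zero => exact contDiffOn_zero.2 h.eta_continuousOn
  | succ n ih =>
    refine (contDiffOn_succ_iff_derivWithin (n := (n : WithTop ℕ∞)) hU).2
      ⟨fun t ht => (h.hasDerivWithinAt_eta hT ht).differentiableWithinAt, by simp, ?_⟩
    refine ((h.rescalingRate_contDiffOn.of_le (by exact_mod_cast le_top)).mul ih).congr
      fun t ht => ?_
    exact (h.hasDerivWithinAt_eta hT ht).derivWithin (hU t ht)

theorem contDiffOn_noiseRate (h : RegularSchedule T η σ) (hT : 0 < T) :
    ContDiffOn ℝ ∞ (noiseRate T σ) (Icc 0 T) := by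
  have hpos : ∀ t ∈ Icc 0 T, η t ^ 2 ≠ 0 := fun t ht => (pow_pos (h.eta_pos t ht) 2).ne'
  refine (h.diffusionRate_contDiffOn.div ((h.contDiffOn_eta hT).pow 2) hpos).congr fun t ht => ?_
  exact (mul_div_cancel_left₀ _ (hpos t ht)).symm

theorem hasDerivWithinAt_sigma_sq (h : RegularSchedule T η σ) (hT : 0 < T) {t : ℝ}
    (ht : t ∈ Icc 0 T) :
    HasDerivWithinAt (fun s => σ s ^ 2) (2 * noiseRate T σ t) (Icc 0 T) t := by
  refine hasDerivWithinAt_Icc_of_Ioc (f' := fun s => 2 * noiseRate T σ s) hT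
    (h.sigma_continuousOn.pow 2) (fun s hs => ?_)
    (continuousOn_const.mul (h.contDiffOn_noiseRate hT).continuousOn) ht
  rw [h.noiseRate_eq hs]
  refine ((h.sigma_contDiffOn.differentiableOn (by simp) s hs).hasDerivWithinAt.pow 2).congr_deriv
    ?_
  simp only [dot]
  push_cast
  ring

theorem contDiffOn_sigma_sq (h : RegularSchedule T η σ) (hT : 0 < T) :
    ContDiffOn ℝ ∞ (fun s => σ s ^ 2) (Icc 0 T) :=
  contDiffOn_infty_of_hasDerivWithinAt hT (fun _ ht => h.hasDerivWithinAt_sigma_sq hT ht)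
    (contDiffOn_const.mul (h.contDiffOn_noiseRate hT))

end DiffusionEM.RegularSchedule

variable {lam : ℝ}

theorem lam_add_sq_pos (hlam : 0 < lam) (x : ℝ) : 0 < lam + x ^ 2 := by positivity

theorem coeffN_pos (hlam : 0 < lam) (s : ℝ) : 0 < coeffN σ lam s :=
  div_pos hlam (lam_add_sq_pos hlam _)

theorem contDiffOn_coeffB (h : RegularSchedule T η σ) (hT : 0 < T) (hlam : 0 < lam) :
    ContDiffOn ℝ ∞ (coeffB T σ lam) (Icc 0 T) :=
  (h.contDiffOn_noiseRate hT).div (contDiffOn_const.add (h.contDiffOn_sigma_sq hT))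
    fun _ _ => (lam_add_sq_pos hlam _).ne'

theorem contDiffOn_coeffQ (h : RegularSchedule T η σ) (hT : 0 < T) (hlam : 0 < lam) (α : ℝ) :
    ContDiffOn ℝ ∞ (coeffQ T α η σ lam) (Icc 0 T) :=
  h.rescalingRate_contDiffOn.add (contDiffOn_const.mul (contDiffOn_coeffB h hT hlam))

theorem contDiffOn_coeffN_rpow (h : RegularSchedule T η σ) (hT : 0 < T) (hlam : 0 < lam) (q : ℝ) :
    ContDiffOn ℝ ∞ (fun s => coeffN σ lam s ^ q) (Icc 0 T) :=
  (contDiffOn_const.div (contDiffOn_const.add (h.contDiffOn_sigma_sq hT))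
    fun _ _ => (lam_add_sq_pos hlam _).ne').rpow_const_of_ne fun s _ => (coeffN_pos hlam s).ne'

theorem hasDerivWithinAt_coeffN_rpow (h : RegularSchedule T η σ) (hT : 0 < T) (hlam : 0 < lam)
    (q : ℝ) {s : ℝ} (hs : s ∈ Icc 0 T) :
    HasDerivWithinAt (fun s => coeffN σ lam s ^ q)
      (-(2 * q * coeffB T σ lam s * coeffN σ lam s ^ q)) (Icc 0 T) s := by
  have hpos := lam_add_sq_pos hlam (σ s)
  have hN : HasDerivWithinAt (coeffN σ lam) (-(2 * coeffB T σ lam s * coeffN σ lam s))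
      (Icc 0 T) s := by
    refine ((hasDerivWithinAt_const s _ lam).div
      ((h.hasDerivWithinAt_sigma_sq hT hs).const_add lam) hpos.ne').congr_deriv ?_
    simp only [coeffB, coeffN]
    field_simp
    ring
  refine (hN.rpow_const (p := q) (Or.inl (coeffN_pos hlam s).ne')).congr_deriv ?_
  rw [Real.rpow_sub_one (coeffN_pos hlam s).ne']
  have := (coeffN_pos (σ := σ) hlam s).ne'
  field_simp

/-- Integration by parts against a power of `N`, whose logarithmic derivative is `-2 B`. -/
theorem integral_coeffN_rpow_mul_D1 (h : RegularSchedule T η σ) (hT : 0 < T) (hlam : 0 < lam)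
    (q : ℝ) {F : ℝ → ℝ} (hF : ContDiffOn ℝ ∞ F (Icc 0 T)) :
    ∫ s in (0 : ℝ)..T, coeffN σ lam s ^ q * (D1 T F s - 2 * q * coeffB T σ lam s * F s)
      = coeffN σ lam T ^ q * F T - coeffN σ lam 0 ^ q * F 0 := by
  have hN := contDiffOn_coeffN_rpow h hT hlam q
  refine intervalIntegral.integral_eq_sub_of_hasDerivAt_of_le
    (f := fun s => coeffN σ lam s ^ q * F s) hT.le (hN.mul hF).continuousOn (fun s hs => ?_) ?_
  · have hs' := Ioo_subset_Icc_self hs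
    refine (((hasDerivWithinAt_coeffN_rpow h hT hlam q hs').mul
      (hF.hasDerivWithinAt_D1 hs')).hasDerivAt (Icc_mem_nhds hs.1 hs.2)).congr_deriv ?_
    ring
  · refine ContinuousOn.intervalIntegrable_of_Icc hT.le ?_
    exact (hN.mul ((hF.D1 hT).sub ((contDiffOn_const.mul
      (contDiffOn_coeffB h hT hlam)).mul hF))).continuousOn

/-- Higher derivatives of a solution of `y' = R y`. -/
theorem D2_D3_of_D1_eq_mul (hT : 0 < T) {R y : ℝ → ℝ} (hR : ContDiffOn ℝ ∞ R (Icc 0 T))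
    (hy : ContDiffOn ℝ ∞ y (Icc 0 T)) (Hy : ∀ s ∈ Icc 0 T, D1 T y s = R s * y s) :
    ∀ s ∈ Icc 0 T, D2 T y s = (D1 T R s + R s ^ 2) * y s ∧
      D1 T (D2 T y) s = (D2 T R s + 3 * R s * D1 T R s + R s ^ 3) * y s := by
  have hd : ∀ s ∈ Icc 0 T, HasDerivWithinAt y (R s * y s) (Icc 0 T) s := fun s hs =>
    Hy s hs ▸ hy.hasDerivWithinAt_D1 hs
  have h2 : ∀ s ∈ Icc 0 T, D2 T y s = (D1 T R s + R s ^ 2) * y s := fun s hs => by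
    refine HasDerivWithinAt.D1_eq hT hs (HasDerivWithinAt.congr
      (((hR.hasDerivWithinAt_D1 hs).mul (hd s hs)).congr_deriv ?_) Hy (Hy s hs))
    ring
  refine fun s hs => ⟨h2 s hs, HasDerivWithinAt.D1_eq hT hs (HasDerivWithinAt.congr
    (((((hR.D1 hT).hasDerivWithinAt_D1 hs).add ((hR.hasDerivWithinAt_D1 hs).pow 2)).mul
      (hd s hs)).congr_deriv ?_) h2 (h2 s hs))⟩
  simp only [D2, Pi.add_apply, Pi.pow_apply]
  push_cast
  ring

/-! ### The scalar mean and covariance errors -/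

/-- Ratio of the mean of the `K`-step sampler to the data mean, minus one, in an eigendirection of
variance `lam`. -/
noncomputable def meanError (T α : ℝ) (η σ : ℝ → ℝ) (K : ℕ) (lam : ℝ) : ℝ :=
  schemeSeq T (fun s => -coeffQ T α η σ lam s) (fun _ => 0)
    (fun s => (1 + α) * coeffB T σ lam s * η s) (η T) K K - 1

/-- Variance of the `K`-step sampler minus the data variance, in an eigendirection of variance
`lam`. -/
noncomputable def covError (T α : ℝ) (η σ : ℝ → ℝ) (K : ℕ) (lam : ℝ) : ℝ :=
  schemeSeq T (fun s => -2 * coeffQ T α η σ lam s) (fun s => coeffQ T α η σ lam s ^ 2)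
    (fun s => 2 * α * diffusionRate T η σ s) (η T ^ 2 * (lam + σ T ^ 2)) K K - lam

theorem meanError_isBigO (h : RegularSchedule T η σ) (hT : 0 < T) (α : ℝ) (hlam : 0 < lam) :
    (fun K : ℕ => meanError T α η σ K lam
        - ((T / K) * meanCoeff1 T α η σ lam + (T / K) ^ 2 * meanCoeff2 T α η σ lam))
      =O[atTop] (fun K : ℕ => (T / K) ^ 3) := by
  set A := rescalingRate T η with hA
  set Q := coeffQ T α η σ lam with hQ
  set q := (1 + α) / 2 with hq
  have hAs := h.rescalingRate_contDiffOn
  have hQs := contDiffOn_coeffQ h hT hlam α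
  have hηs := h.contDiffOn_eta hT
  have hNs := contDiffOn_coeffN_rpow h hT hlam q
  have hηne : ∀ s ∈ Icc 0 T, η s ≠ 0 := fun s hs => (h.eta_pos s hs).ne'
  have hη : ∀ s ∈ Icc 0 T, D1 T η s = A s * η s := fun s hs =>
    (h.hasDerivWithinAt_eta hT hs).D1_eq hT hs
  have hder := D2_D3_of_D1_eq_mul hT hAs hηs hη
  have hN0 : coeffN σ lam 0 = 1 := by simp [coeffN, h.sigma_zero, hlam.ne']
  have main := schemeSeq_expansion (p := fun s => -Q s) (r := fun _ => 0)
    (g := fun s => (1 + α) * coeffB T σ lam s * η s) (y := η)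
    (Φ := fun s => coeffN σ lam s ^ q / η s) hT hQs.neg contDiffOn_const hηs
    (hNs.div hηs hηne)
    (fun s hs => div_pos (Real.rpow_pos_of_pos (coeffN_pos hlam s) _) (h.eta_pos s hs))
    (by simp [hN0, h.eta_zero])
    (fun s hs => by
      refine HasDerivWithinAt.D1_eq hT hs (((hasDerivWithinAt_coeffN_rpow h hT hlam q hs).div
        (h.hasDerivWithinAt_eta hT hs) (hηne s hs)).congr_deriv ?_)
      have := hηne s hs
      simp only [hQ, coeffQ, ← hA, hq]
      field_simp
      ring)
    (fun s hs => by rw [hη s hs]; simp only [hQ, coeffQ, ← hA]; ring)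
  have hint : ∀ s ∈ Icc 0 T, coeffN σ lam s ^ q / η s * (0 * η s - D2 T η s / 2)
      = -(1 / 2) * (coeffN σ lam s ^ q * (D1 T A s + A s ^ 2)) := fun s hs => by
    have := hηne s hs
    rw [(hder s hs).1]
    field_simp
    ring
  have htail : ∀ s ∈ Icc 0 T, ∫ w in s..T, coeffN σ lam w ^ q / η w * (0 * η w - D2 T η w / 2)
      = meanTail1 T α η σ lam s := fun s hs => by
    rw [meanTail1, ← intervalIntegral.integral_const_mul]
    refine intervalIntegral.integral_congr fun w hw => hint w ?_
    rw [uIcc_of_le hs.2] at hw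
    exact ⟨hs.1.trans hw.1, hw.2⟩
  have hE₁ : ∫ w in (0 : ℝ)..T, coeffN σ lam w ^ q / η w * (0 * η w - D2 T η w / 2)
      = meanCoeff1 T α η σ lam := by
    rw [htail 0 ⟨le_rfl, hT.le⟩, meanTail1, meanCoeff1, meanBoundary,
      ← integral_coeffN_rpow_mul_D1 h hT hlam ((1 + α) / 2) hAs, ← mul_add,
      ← intervalIntegral.integral_add]
    · congr 1
      refine intervalIntegral.integral_congr fun s _ => ?_
      ring
    · refine ContinuousOn.intervalIntegrable_of_Icc hT.le
        (ContDiffOn.continuousOn (𝕜 := ℝ) (n := ∞) ?_)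
      exact (hNs.mul hAs).mul hQs
    · refine ContinuousOn.intervalIntegrable_of_Icc hT.le
        (ContDiffOn.continuousOn (𝕜 := ℝ) (n := ∞) ?_)
      exact hNs.mul ((hAs.D1 hT).sub ((contDiffOn_const.mul (contDiffOn_coeffB h hT hlam)).mul hAs))
  have hE₂ : ∫ s in (0 : ℝ)..T, ((0 + (D1 T (fun s => -Q s) s - (-Q s) ^ 2) / 2)
        * (∫ w in s..T, coeffN σ lam w ^ q / η w * (0 * η w - D2 T η w / 2))
      + coeffN σ lam s ^ q / η s * ((D1 T (fun _ => 0) s * η s + 0 * D1 T η s) / 2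
        - -Q s * 0 * η s / 2 + -Q s * D2 T η s / 4 - D1 T (D2 T η) s / 12))
      = meanCoeff2 T α η σ lam := by
    refine intervalIntegral.integral_congr fun s hs => ?_
    rw [uIcc_of_le hT.le] at hs
    have hne := hηne s hs
    have e1 : D1 T (fun s => -Q s) s = -D1 T Q s :=
      HasDerivWithinAt.D1_eq hT hs (hQs.hasDerivWithinAt_D1 hs).neg
    have e2 : D1 T (fun _ => (0 : ℝ)) s = 0 :=
      HasDerivWithinAt.D1_eq hT hs (hasDerivWithinAt_const _ _ _)
    simp only [htail s hs, e1, e2, (hder s hs).1, (hder s hs).2]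
    field_simp
    ring
  rw [hE₁, hE₂, h.eta_zero] at main
  exact main

theorem covError_isBigO (h : RegularSchedule T η σ) (hT : 0 < T) (α : ℝ) (hlam : 0 < lam) :
    (fun K : ℕ => covError T α η σ K lam
        - ((T / K) * covCoeff1 T α η σ lam + (T / K) ^ 2 * covCoeff2 T α η σ lam))
      =O[atTop] (fun K : ℕ => (T / K) ^ 3) := by
  set A := rescalingRate T η with hA
  set B := coeffB T σ lam with hB
  set Q := coeffQ T α η σ lam with hQ
  have hAs := h.rescalingRate_contDiffOn
  have hBs := contDiffOn_coeffB h hT hlam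
  have hQs := contDiffOn_coeffQ h hT hlam α
  have hABs : ContDiffOn ℝ ∞ (fun s => A s + B s) (Icc 0 T) := hAs.add hBs
  have hNs := contDiffOn_coeffN_rpow h hT hlam α
  have hηne : ∀ s ∈ Icc 0 T, η s ≠ 0 := fun s hs => (h.eta_pos s hs).ne'
  have hη2 : ContDiffOn ℝ ∞ (fun s => η s ^ 2) (Icc 0 T) := (h.contDiffOn_eta hT).pow 2
  set C : ℝ → ℝ := fun s => η s ^ 2 * (lam + σ s ^ 2) with hC
  set R : ℝ → ℝ := fun s => 2 * (A s + B s) with hR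
  have hCs : ContDiffOn ℝ ∞ C (Icc 0 T) :=
    hη2.mul (contDiffOn_const.add (h.contDiffOn_sigma_sq hT))
  have hRs : ContDiffOn ℝ ∞ R (Icc 0 T) := contDiffOn_const.mul hABs
  have hη2d : ∀ s ∈ Icc 0 T, HasDerivWithinAt (fun s => η s ^ 2) (2 * A s * η s ^ 2) (Icc 0 T) s :=
    fun s hs => ((h.hasDerivWithinAt_eta hT hs).pow 2).congr_deriv (by push_cast; ring)
  have hBn : ∀ s, noiseRate T σ s = B s * (lam + σ s ^ 2) := fun s =>
    (div_mul_cancel₀ _ (lam_add_sq_pos hlam (σ s)).ne').symm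
  have hC1 : ∀ s ∈ Icc 0 T, D1 T C s = R s * C s := fun s hs => by
    refine HasDerivWithinAt.D1_eq hT hs (((hη2d s hs).mul
      ((h.hasDerivWithinAt_sigma_sq hT hs).const_add lam)).congr_deriv ?_)
    simp only [hR, hC, hBn]
    ring
  have hder := D2_D3_of_D1_eq_mul hT hRs hCs hC1
  have hR1 : ∀ s ∈ Icc 0 T, D1 T R s = 2 * (D1 T A s + D1 T B s) := fun s hs =>
    HasDerivWithinAt.D1_eq hT hs
      (((hAs.hasDerivWithinAt_D1 hs).add (hBs.hasDerivWithinAt_D1 hs)).const_mul 2)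
  have hR2 : ∀ s ∈ Icc 0 T, D2 T R s = 2 * (D2 T A s + D2 T B s) := fun s hs =>
    HasDerivWithinAt.D1_eq hT hs (HasDerivWithinAt.congr
      ((((hAs.D1 hT).hasDerivWithinAt_D1 hs).add
        ((hBs.D1 hT).hasDerivWithinAt_D1 hs)).const_mul 2) hR1 (hR1 s hs))
  have hN0 : coeffN σ lam 0 = 1 := by simp [coeffN, h.sigma_zero, hlam.ne']
  -- the propagator, applied to the exact variance
  have hΦC : ∀ s ∈ Icc 0 T, coeffN σ lam s ^ (1 + α) / η s ^ 2 * C s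
      = lam * coeffN σ lam s ^ α := fun s hs => by
    have h1 := hηne s hs
    have h2 := (lam_add_sq_pos hlam (σ s)).ne'
    rw [Real.rpow_add (coeffN_pos hlam s), Real.rpow_one]
    simp only [hC, coeffN]
    field_simp
  have main := schemeSeq_expansion (p := fun s => -2 * Q s) (r := fun s => Q s ^ 2)
    (g := fun s => 2 * α * diffusionRate T η σ s) (y := C)
    (Φ := fun s => coeffN σ lam s ^ (1 + α) / η s ^ 2) hT (contDiffOn_const.mul hQs) (hQs.pow 2) hCs
    ((contDiffOn_coeffN_rpow h hT hlam (1 + α)).div hη2 fun s hs => pow_ne_zero 2 (hηne s hs))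
    (fun s hs => div_pos (Real.rpow_pos_of_pos (coeffN_pos hlam s) _) (pow_pos (h.eta_pos s hs) 2))
    (by simp [hN0, h.eta_zero])
    (fun s hs => by
      refine HasDerivWithinAt.D1_eq hT hs (((hasDerivWithinAt_coeffN_rpow h hT hlam (1 + α) hs).div
        (hη2d s hs) (pow_ne_zero 2 (hηne s hs))).congr_deriv ?_)
      have := hηne s hs
      simp only [hQ, coeffQ, ← hA, ← hB]
      field_simp
      ring)
    (fun s hs => by
      rw [hC1 s hs]
      simp only [hQ, coeffQ, ← hA, ← hB, hR, hC, diffusionRate, hBn]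
      ring)
  have hint : ∀ s ∈ Icc 0 T, coeffN σ lam s ^ (1 + α) / η s ^ 2 * (Q s ^ 2 * C s - D2 T C s / 2)
      = -lam * (coeffN σ lam s ^ α
        * (D1 T A s + D1 T B s + 2 * (A s + B s) ^ 2 - Q s ^ 2)) := fun s hs => by
    rw [(hder s hs).1, hR1 s hs]
    simp only [hR]
    linear_combination (Q s ^ 2 - (D1 T A s + D1 T B s + 2 * (A s + B s) ^ 2)) * hΦC s hs
  have htail : ∀ s ∈ Icc 0 T,
      ∫ w in s..T, coeffN σ lam w ^ (1 + α) / η w ^ 2 * (Q w ^ 2 * C w - D2 T C w / 2)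
      = covTail1 T α η σ lam s := fun s hs => by
    rw [covTail1, ← intervalIntegral.integral_const_mul]
    refine intervalIntegral.integral_congr fun w hw => hint w ?_
    rw [uIcc_of_le hs.2] at hw
    exact ⟨hs.1.trans hw.1, hw.2⟩
  have hE₁ : ∫ w in (0 : ℝ)..T,
        coeffN σ lam w ^ (1 + α) / η w ^ 2 * (Q w ^ 2 * C w - D2 T C w / 2)
      = covCoeff1 T α η σ lam := by
    have hbd : covBoundary T α η σ lam = -lam * (coeffN σ lam T ^ α * (A T + B T)
        - coeffN σ lam 0 ^ α * (A 0 + B 0)) := by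
      rw [covBoundary]
      ring
    have hparts := integral_coeffN_rpow_mul_D1 h hT hlam α hABs
    rw [htail 0 ⟨le_rfl, hT.le⟩, covTail1, covCoeff1, hbd, ← hparts, ← mul_add,
      ← intervalIntegral.integral_add]
    · congr 1
      refine intervalIntegral.integral_congr fun s hs => ?_
      rw [uIcc_of_le hT.le] at hs
      have e : D1 T (fun s => A s + B s) s = D1 T A s + D1 T B s := HasDerivWithinAt.D1_eq hT hs
        ((hAs.hasDerivWithinAt_D1 hs).add (hBs.hasDerivWithinAt_D1 hs))
      simp only [← hA, ← hB, e, coeffQ]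
      ring
    · refine ContinuousOn.intervalIntegrable_of_Icc hT.le
        (ContDiffOn.continuousOn (𝕜 := ℝ) (n := ∞) ?_)
      exact hNs.mul ((hABs.pow 2).sub (contDiffOn_const.mul (hBs.pow 2)))
    · refine ContinuousOn.intervalIntegrable_of_Icc hT.le
        (ContDiffOn.continuousOn (𝕜 := ℝ) (n := ∞) ?_)
      exact hNs.mul ((hABs.D1 hT).sub ((contDiffOn_const.mul hBs).mul hABs))
  have hE₂ : ∫ s in (0 : ℝ)..T, ((Q s ^ 2 + (D1 T (fun s => -2 * Q s) s - (-2 * Q s) ^ 2) / 2)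
        * (∫ w in s..T, coeffN σ lam w ^ (1 + α) / η w ^ 2 * (Q w ^ 2 * C w - D2 T C w / 2))
      + coeffN σ lam s ^ (1 + α) / η s ^ 2
        * ((D1 T (fun s => Q s ^ 2) s * C s + Q s ^ 2 * D1 T C s) / 2
        - -2 * Q s * Q s ^ 2 * C s / 2 + -2 * Q s * D2 T C s / 4 - D1 T (D2 T C) s / 12))
      = covCoeff2 T α η σ lam := by
    refine intervalIntegral.integral_congr fun s hs => ?_
    rw [uIcc_of_le hT.le] at hs
    have hq := hQs.hasDerivWithinAt_D1 hs
    have e1 : D1 T (fun s => -2 * Q s) s = -2 * D1 T Q s :=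
      HasDerivWithinAt.D1_eq hT hs (hq.const_mul (-2))
    have e2 : D1 T (fun s => Q s ^ 2) s = 2 * Q s * D1 T Q s :=
      HasDerivWithinAt.D1_eq hT hs ((hq.pow 2).congr_deriv (by push_cast; ring))
    have eQ : Q s = A s + (1 + α) * B s := rfl
    simp only [htail s hs, e1, e2, (hder s hs).1, (hder s hs).2, hC1 s hs, hR1 s hs, hR2 s hs]
    simp only [hR, ← hA, ← hB, ← hQ]
    have hα : α * B s = Q s - (A s + B s) := by rw [eQ]; ring
    rw [hα]
    linear_combination (Q s * D1 T Q s + Q s ^ 2 * (A s + B s) + Q s ^ 3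
      - Q s * (D1 T A s + D1 T B s + 2 * (A s + B s) ^ 2)
      - (1 / 6) * (D2 T A s + D2 T B s + 6 * (A s + B s) * (D1 T A s + D1 T B s)
        + 4 * (A s + B s) ^ 3)) * hΦC s hs
  have hC0 : C 0 = lam := by simp [hC, h.eta_zero, h.sigma_zero]
  rw [hE₁, hE₂, hC0] at main
  exact main

/-! ### Boundary terms at large terminal noise -/

theorem meanBoundary_covBoundary_tendsto {ι : Type v} {l : Filter ι} {η σ : ι → ℝ → ℝ} {α : ℝ}
    (hT : 0 < T) (hα : 0 ≤ α) (hreg : ∀ i, RegularSchedule T (η i) (σ i))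
    (hl : LargeTerminalNoise T α l η σ) (hlam : 0 < lam) :
    Tendsto (fun i => meanBoundary T α (η i) (σ i) lam) l (𝓝 0) ∧
      Tendsto (fun i => covBoundary T α (η i) (σ i) lam) l (𝓝 0) := by
  have hTm : T ∈ Ioc 0 T := ⟨hT, le_rfl⟩
  have hnoise0 : ∀ i, noiseRate T (σ i) 0 = 0 := fun i => by
    simpa [diffusionRate, (hreg i).eta_zero] using hl.diffusionRate_zero i
  set a : ι → ℝ := fun i => dot T (η i) T / η i T with ha
  set b : ι → ℝ := fun i => dot T (σ i) T / σ i T with hb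
  have hpos : ∀ᶠ i in l, 0 < σ i T := hl.tendsto_sigma.eventually_gt_atTop 0
  -- `N` is at most `λ σ⁻²`, so it turns into the weights of the two hypotheses
  have hNle : ∀ q : ℝ, 0 ≤ q → ∀ᶠ i in l,
      |coeffN (σ i) lam T ^ q| ≤ lam ^ q * σ i T ^ (-(2 * q)) := fun q hq => by
    filter_upwards [hpos] with i hi
    rw [abs_of_pos (Real.rpow_pos_of_pos (coeffN_pos hlam T) q), Real.rpow_neg hi.le,
      Real.rpow_mul hi.le, Real.rpow_two, ← div_eq_mul_inv,
      ← Real.div_rpow hlam.le (sq_nonneg _)]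
    refine Real.rpow_le_rpow (coeffN_pos hlam T).le ?_ hq
    unfold coeffN
    gcongr
    linarith
  have hweight : ∀ (q : ℝ) (f : ι → ℝ), 0 ≤ q →
      Tendsto (fun i => σ i T ^ (-(2 * q)) * f i) l (𝓝 0) →
      Tendsto (fun i => coeffN (σ i) lam T ^ q * f i) l (𝓝 0) := fun q f hq hf => by
    refine squeeze_zero_norm' (a := fun i => lam ^ q * |σ i T ^ (-(2 * q)) * f i|) ?_ ?_
    · filter_upwards [hNle q hq, hpos] with i hi hp
      rw [Real.norm_eq_abs, abs_mul, abs_mul, abs_of_pos (Real.rpow_pos_of_pos hp _), ← mul_assoc]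
      gcongr
    · simpa using hf.abs.const_mul (lam ^ q)
  have hN1 : ∀ i, |coeffN (σ i) lam T| ≤ 1 := fun i => by
    rw [abs_of_pos (coeffN_pos hlam T), coeffN, div_le_one (lam_add_sq_pos hlam _)]
    nlinarith [sq_nonneg (σ i T)]
  have hmul : ∀ (q : ℝ) (f : ι → ℝ), 0 ≤ q → Tendsto f l (𝓝 0) →
      Tendsto (fun i => coeffN (σ i) lam T ^ q * f i) l (𝓝 0) := fun q f hq hf => by
    refine squeeze_zero_norm (a := fun i => |f i|) (fun i => ?_) (by simpa using hf.abs)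
    rw [Real.norm_eq_abs, abs_mul]
    refine mul_le_of_le_one_left (abs_nonneg _) ?_
    rw [abs_of_pos (Real.rpow_pos_of_pos (coeffN_pos hlam T) q)]
    exact Real.rpow_le_one (coeffN_pos hlam T).le ((le_abs_self _).trans (hN1 i)) hq
  have hmean : Tendsto (fun i => coeffN (σ i) lam T ^ ((1 + α) / 2) * a i) l (𝓝 0) :=
    hweight _ _ (by positivity) (by
      convert hl.tendsto_rescaling using 4
      ring)
  have hsum : Tendsto (fun i => coeffN (σ i) lam T ^ α * (a i + b i)) l (𝓝 0) :=
    hweight _ _ hα hl.tendsto_noise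
  constructor
  · have := hmean.const_mul (-(1 / 2))
    rw [mul_zero] at this
    refine this.congr fun i => ?_
    rw [meanBoundary, (hreg i).rescalingRate_eq hTm, hl.rescalingRate_zero]
    ring
  · -- `A + B = (A + σ̇ / σ) - N σ̇ / σ` at the terminal time
    have h1 := hmul 1 _ zero_le_one hsum
    have h2 := hmul ((1 + α) / 2) _ (by positivity) hmean
    have := ((hsum.sub (h1.sub h2))).const_mul (-lam)
    simp only [sub_zero, mul_zero] at this
    refine this.congr' ?_
    filter_upwards [hpos] with i hi
    have hN := coeffN_pos (σ := σ i) hlam T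
    have hB : coeffB T (σ i) lam T = b i - coeffN (σ i) lam T * b i := by
      have := (lam_add_sq_pos hlam (σ i T)).ne'
      rw [coeffB, (hreg i).noiseRate_eq hTm]
      simp only [coeffN, hb]
      field_simp
      ring
    have hpw : coeffN (σ i) lam T ^ ((1 + α) / 2) * coeffN (σ i) lam T ^ ((1 + α) / 2)
        = coeffN (σ i) lam T * coeffN (σ i) lam T ^ α := by
      rw [← Real.rpow_add hN, add_halves, Real.rpow_add hN, Real.rpow_one]
    rw [covBoundary, hB, (hreg i).rescalingRate_eq hTm, hl.rescalingRate_zero, coeffB,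
      hnoise0, zero_div, Real.rpow_one]
    change _ = -(lam * coeffN (σ i) lam T ^ α * (a i + _) - _)
    linear_combination (-lam * a i) * hpw

end Schedule

open scoped RealInnerProductSpace

/-! ### Gaussian laws in an orthonormal basis: densities and scores -/

section Gaussian

variable {d : ℕ} (b : OrthonormalBasis (Fin d) ℝ (EuclideanSpace ℝ (Fin d)))

/-- The operator that multiplies the `i`-th coordinate in the orthonormal basis `b` by `r i`. -/
noncomputable def diagOp (r : Fin d → ℝ) :
    EuclideanSpace ℝ (Fin d) →L[ℝ] EuclideanSpace ℝ (Fin d) :=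
  ∑ i, r i • (innerSL ℝ (b i)).smulRight (b i)

theorem diagOp_apply (r : Fin d → ℝ) (x : EuclideanSpace ℝ (Fin d)) :
    diagOp b r x = ∑ i, (r i * ⟪b i, x⟫) • b i := by
  simp [diagOp, smul_smul]

theorem inner_diagOp (r : Fin d → ℝ) (x : EuclideanSpace ℝ (Fin d)) (j : Fin d) :
    ⟪b j, diagOp b r x⟫ = r j * ⟪b j, x⟫ := by
  rw [diagOp_apply, b.orthonormal.inner_right_fintype]

theorem OrthonormalBasis.ext_inner {x y : EuclideanSpace ℝ (Fin d)}
    (h : ∀ j, ⟪b j, x⟫ = ⟪b j, y⟫) : x = y := by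
  rw [← b.sum_repr' x, ← b.sum_repr' y]
  simp only [h]

theorem diagOp_comp {r s : Fin d → ℝ} (h : ∀ i, r i * s i = 1) (x : EuclideanSpace ℝ (Fin d)) :
    diagOp b r (diagOp b s x) = x :=
  b.ext_inner fun j => by rw [inner_diagOp, inner_diagOp, ← mul_assoc, h, one_mul]

theorem inner_diagOp_left (r : Fin d → ℝ) (x y : EuclideanSpace ℝ (Fin d)) :
    ⟪diagOp b r x, y⟫ = ⟪x, diagOp b r y⟫ := by
  rw [← b.sum_inner_mul_inner (diagOp b r x) y, ← b.sum_inner_mul_inner x (diagOp b r y)]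
  refine Finset.sum_congr rfl fun i _ => ?_
  rw [real_inner_comm, inner_diagOp, inner_diagOp, real_inner_comm]
  ring

theorem norm_diagOp_sq (r : Fin d → ℝ) (x : EuclideanSpace ℝ (Fin d)) :
    ‖diagOp b r x‖ ^ 2 = ∑ i, r i ^ 2 * ⟪b i, x⟫ ^ 2 := by
  rw [← b.sum_sq_inner_right]
  simp only [inner_diagOp, mul_pow]

/-- The Gaussian law with mean `m` whose covariance has eigenbasis `b` and eigenvalues `r i ^ 2`. -/
noncomputable def basisGaussian (m : EuclideanSpace ℝ (Fin d)) (r : Fin d → ℝ) :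
    Measure (EuclideanSpace ℝ (Fin d)) :=
  (stdGaussian (EuclideanSpace ℝ (Fin d))).map fun z => m + diagOp b r z

instance (m : EuclideanSpace ℝ (Fin d)) (r : Fin d → ℝ) :
    IsProbabilityMeasure (basisGaussian b m r) :=
  Measure.isProbabilityMeasure_map (by fun_prop)

theorem charFun_basisGaussian (m : EuclideanSpace ℝ (Fin d)) (r : Fin d → ℝ)
    (t : EuclideanSpace ℝ (Fin d)) :
    charFun (basisGaussian b m r) t
      = Complex.exp (⟪m, t⟫ * Complex.I - (∑ i, r i ^ 2 * ⟪b i, t⟫ ^ 2 : ℝ) / 2) := by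
  have hcomp : basisGaussian b m r
      = ((stdGaussian (EuclideanSpace ℝ (Fin d))).map (diagOp b r)).map (m + ·) := by
    rw [basisGaussian, Measure.map_map (by fun_prop) (by fun_prop)]
    rfl
  have hstd : charFun ((stdGaussian (EuclideanSpace ℝ (Fin d))).map (diagOp b r)) t
      = charFun (stdGaussian (EuclideanSpace ℝ (Fin d))) (diagOp b r t) := by
    rw [charFun_apply, charFun_apply, integral_map (by fun_prop) (by fun_prop)]
    simp only [inner_diagOp_left]
  rw [hcomp, charFun_map_const_add, hstd, charFun_stdGaussian, ← norm_diagOp_sq, ← Complex.exp_add]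
  congr 1
  push_cast
  ring

/-- The Lebesgue density of the standard Gaussian law, up to identifying the constant. -/
theorem stdGaussian_eq_withDensity : ∃ κ : ℝ, 0 < κ ∧
    stdGaussian (EuclideanSpace ℝ (Fin d))
      = volume.withDensity fun x => ENNReal.ofReal (κ * Real.exp (-(1 / 2) * ‖x‖ ^ 2)) := by
  set Z : ℝ := ∫ x : EuclideanSpace ℝ (Fin d), Real.exp (-(1 / 2) * ‖x‖ ^ 2) with hZ
  have hZval := GaussianFourier.integral_rexp_neg_mul_sq_norm
    (V := EuclideanSpace ℝ (Fin d)) (b := 1 / 2) (by norm_num)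
  have hZpos : 0 < Z := by
    rw [hZ, hZval]
    positivity
  have hcast : ∀ x : EuclideanSpace ℝ (Fin d),
      ((Real.exp (-(1 / 2) * ‖x‖ ^ 2) : ℝ) : ℂ) = Complex.exp (-(1 / 2 : ℂ) * ‖x‖ ^ 2) :=
    fun x => by push_cast; rfl
  have hre : 0 < (1 / 2 : ℂ).re := by norm_num
  have hint : Integrable fun x : EuclideanSpace ℝ (Fin d) => Real.exp (-(1 / 2) * ‖x‖ ^ 2) := by
    have := (GaussianFourier.integrable_cexp_neg_mul_sq_norm_add hre 0
      (0 : EuclideanSpace ℝ (Fin d))).re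
    refine this.congr (Eventually.of_forall fun x => ?_)
    simp only [zero_mul, add_zero, ← hcast]
    exact Complex.ofReal_re _
  have hZc : (Z : ℂ) = (Real.pi / (1 / 2 : ℂ))
      ^ (Module.finrank ℝ (EuclideanSpace ℝ (Fin d)) / 2 : ℂ) := by
    rw [hZ, ← integral_complex_ofReal, ← GaussianFourier.integral_cexp_neg_mul_sq_norm hre]
    simp only [hcast]
  refine ⟨Z⁻¹, inv_pos.2 hZpos, ?_⟩
  have hmeas : Measurable fun x : EuclideanSpace ℝ (Fin d) =>
      ENNReal.ofReal (Z⁻¹ * Real.exp (-(1 / 2) * ‖x‖ ^ 2)) := by fun_prop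
  have : IsFiniteMeasure ((volume : Measure (EuclideanSpace ℝ (Fin d))).withDensity fun x =>
      ENNReal.ofReal (Z⁻¹ * Real.exp (-(1 / 2) * ‖x‖ ^ 2))) :=
    isFiniteMeasure_withDensity_ofReal (hint.const_mul _).2
  refine Measure.ext_of_charFun (funext fun t => ?_)
  rw [charFun_stdGaussian, charFun_apply, integral_withDensity_eq_integral_toReal_smul hmeas
    (Eventually.of_forall fun _ => ENNReal.ofReal_lt_top)]
  have hfun : ∀ x : EuclideanSpace ℝ (Fin d),
      (ENNReal.ofReal (Z⁻¹ * Real.exp (-(1 / 2) * ‖x‖ ^ 2))).toReal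
          • Complex.exp (⟪x, t⟫ * Complex.I)
        = (Z : ℂ)⁻¹ * Complex.exp (-(1 / 2 : ℂ) * ‖x‖ ^ 2 + Complex.I * ⟪t, x⟫) := fun x => by
    rw [ENNReal.toReal_ofReal (by positivity), Complex.real_smul, Complex.ofReal_mul, hcast,
      Complex.exp_add, Complex.ofReal_inv, real_inner_comm, mul_comm Complex.I, mul_assoc]
  simp only [hfun]
  rw [integral_const_mul, GaussianFourier.integral_cexp_neg_mul_sq_norm_add hre, ← hZc,
    inv_mul_cancel_left₀ (by exact_mod_cast hZpos.ne')]
  congr 1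
  rw [Complex.I_sq]
  ring

theorem exists_density_basisGaussian (m : EuclideanSpace ℝ (Fin d)) {r : Fin d → ℝ}
    (hr : ∀ i, r i ≠ 0) : ∃ κ : ℝ, 0 < κ ∧ IsContinuousDensity (basisGaussian b m r)
      fun x => κ * Real.exp (-(1 / 2) * ‖diagOp b r⁻¹ (x - m)‖ ^ 2) := by
  obtain ⟨κ, hκ, hstd⟩ := stdGaussian_eq_withDensity (d := d)
  have hinv : ∀ x, diagOp b r⁻¹ (diagOp b r x) = x := diagOp_comp b fun i => by simp [hr i]
  have hinv' : ∀ x, diagOp b r (diagOp b r⁻¹ x) = x := diagOp_comp b fun i => by simp [hr i]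
  have hdet : LinearMap.det (diagOp b r : EuclideanSpace ℝ (Fin d) →ₗ[ℝ] _) ≠ 0 := by
    have : (diagOp b r : EuclideanSpace ℝ (Fin d) →ₗ[ℝ] _)
        ∘ₗ (diagOp b r⁻¹ : EuclideanSpace ℝ (Fin d) →ₗ[ℝ] _) = LinearMap.id :=
      LinearMap.ext hinv'
    have h1 := congrArg LinearMap.det this
    rw [LinearMap.det_comp, LinearMap.det_id] at h1
    exact left_ne_zero_of_mul_eq_one h1
  set D := |(LinearMap.det (diagOp b r : EuclideanSpace ℝ (Fin d) →ₗ[ℝ] _))⁻¹| with hD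
  have hDpos : 0 < D := abs_pos.2 (inv_ne_zero hdet)
  have hF : Measurable fun z => m + diagOp b r z := by fun_prop
  have hvol : (volume : Measure (EuclideanSpace ℝ (Fin d))).map (fun z => m + diagOp b r z)
      = ENNReal.ofReal D • volume := by
    have : (fun z => m + diagOp b r z) = (m + ·) ∘ diagOp b r := rfl
    rw [this, ← Measure.map_map (by fun_prop) (by fun_prop)]
    have h2 := Measure.map_linearMap_addHaar_eq_smul_addHaar
      (volume : Measure (EuclideanSpace ℝ (Fin d))) hdet
    rw [ContinuousLinearMap.coe_coe] at h2
    rw [h2, Measure.map_smul, map_add_left_eq_self]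
  refine ⟨D * κ, by positivity, by fun_prop, fun x => by positivity, ?_⟩
  refine Measure.ext_of_lintegral _ fun g hg => ?_
  have hdens : Measurable fun x : EuclideanSpace ℝ (Fin d) =>
      ENNReal.ofReal (κ * Real.exp (-(1 / 2) * ‖x‖ ^ 2)) := by fun_prop
  have hG : Measurable fun x => ENNReal.ofReal (κ * Real.exp (-(1 / 2)
      * ‖diagOp b r⁻¹ (x - m)‖ ^ 2)) := by fun_prop
  have hG' : Measurable fun x => ENNReal.ofReal (D * κ * Real.exp (-(1 / 2)
      * ‖diagOp b r⁻¹ (x - m)‖ ^ 2)) := by fun_prop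
  beta_reduce
  rw [basisGaussian, lintegral_map hg hF, hstd, lintegral_withDensity_eq_lintegral_mul _ hdens
    (g := fun z => g (m + diagOp b r z)) (hg.comp hF),
    lintegral_withDensity_eq_lintegral_mul _ hG' hg]
  simp only [Pi.mul_apply]
  calc ∫⁻ z, ENNReal.ofReal (κ * Real.exp (-(1 / 2) * ‖z‖ ^ 2)) * g (m + diagOp b r z)
      = ∫⁻ z, ENNReal.ofReal (κ * Real.exp (-(1 / 2) * ‖diagOp b r⁻¹ (m + diagOp b r z - m)‖ ^ 2))
          * g (m + diagOp b r z) := by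
        simp only [add_sub_cancel_left, hinv]
    _ = ∫⁻ x, ENNReal.ofReal (κ * Real.exp (-(1 / 2) * ‖diagOp b r⁻¹ (x - m)‖ ^ 2)) * g x
          ∂(volume.map fun z => m + diagOp b r z) :=
        (lintegral_map (hG.mul hg) hF).symm
    _ = ∫⁻ x, ENNReal.ofReal D * (ENNReal.ofReal (κ * Real.exp (-(1 / 2)
          * ‖diagOp b r⁻¹ (x - m)‖ ^ 2)) * g x) := by
        rw [hvol, lintegral_smul_measure, smul_eq_mul]
        exact (lintegral_const_mul _ (hG.mul hg)).symm
    _ = _ := by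
        refine lintegral_congr fun x => ?_
        rw [mul_assoc D, ENNReal.ofReal_mul hDpos.le, mul_assoc]

/-- Continuous densities that agree almost everywhere agree everywhere, so the choice made in
`continuousDensity` is immaterial. -/
theorem DiffusionEM.IsContinuousDensity.unique {m : Measure (EuclideanSpace ℝ (Fin d))}
    {f g : EuclideanSpace ℝ (Fin d) → ℝ} (hf : IsContinuousDensity m f)
    (hg : IsContinuousDensity m g) : f = g := by
  have h := hf.2.2.symm.trans hg.2.2
  rw [withDensity_eq_iff_of_sigmaFinite hf.1.measurable.ennreal_ofReal.aemeasurable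
    hg.1.measurable.ennreal_ofReal.aemeasurable] at h
  refine (hf.1.ae_eq_iff_eq volume hg.1).1 (h.mono fun x hx => ?_)
  exact (ENNReal.ofReal_eq_ofReal_iff (hf.2.1 x) (hg.2.1 x)).1 hx

theorem DiffusionEM.IsContinuousDensity.continuousDensity_eq
    {m : Measure (EuclideanSpace ℝ (Fin d))}
    {f : EuclideanSpace ℝ (Fin d) → ℝ} (hf : IsContinuousDensity m f) :
    continuousDensity m = f := by
  have h : ∃ f, IsContinuousDensity m f := ⟨f, hf⟩
  rw [continuousDensity, dif_pos h]
  exact h.choose_spec.unique hf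

/-- The score of a Gaussian law is `-Σ⁻¹ (x - m)`, read in the eigenbasis of `Σ`. -/
theorem inner_score_basisGaussian (m : EuclideanSpace ℝ (Fin d)) {r : Fin d → ℝ}
    (hr : ∀ i, r i ≠ 0) (x : EuclideanSpace ℝ (Fin d)) (i : Fin d) :
    ⟪b i, score (basisGaussian b m r) x⟫ = -(⟪b i, x - m⟫ / r i ^ 2) := by
  obtain ⟨κ, hκ, hdens⟩ := exists_density_basisGaussian b m hr
  have hlog : (fun y => Real.log (continuousDensity (basisGaussian b m r) y))
      = fun y => Real.log κ + -(1 / 2) * ‖diagOp b r⁻¹ (y - m)‖ ^ 2 := by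
    funext y
    rw [hdens.continuousDensity_eq, Real.log_mul hκ.ne' (Real.exp_pos _).ne', Real.log_exp]
  have hd : HasFDerivAt (fun y => Real.log κ + -(1 / 2) * ‖diagOp b r⁻¹ (y - m)‖ ^ 2)
      (-(1 / 2 : ℝ) • (2 • (innerSL ℝ (diagOp b r⁻¹ (x - m))).comp (diagOp b r⁻¹))) x := by
    have h1 : HasFDerivAt (fun y => diagOp b r⁻¹ (y - m)) (diagOp b r⁻¹) x :=
      (diagOp b r⁻¹).hasFDerivAt.comp x ((hasFDerivAt_id x).sub_const m)
    exact (h1.norm_sq.const_mul (-(1 / 2 : ℝ))).const_add _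
  rw [score, hlog, hd.hasGradientAt.gradient, real_inner_comm,
    InnerProductSpace.toDual_symm_apply]
  have : diagOp b r⁻¹ (b i) = (r i)⁻¹ • b i := b.ext_inner fun j => by
    rw [inner_diagOp, inner_smul_right, b.inner_eq_ite]
    by_cases hij : j = i
    · simp [hij]
    · simp [hij]
  simp only [smul_apply, ContinuousLinearMap.comp_apply, innerSL_apply_apply,
    this, inner_smul_right, nsmul_eq_mul, smul_eq_mul]
  rw [real_inner_comm, inner_diagOp]
  have := hr i
  simp only [Pi.inv_apply]
  push_cast
  field_simp

end Gaussian

/-! ### Forward marginals of Gaussian data -/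

section Forward

variable {d : ℕ}

theorem forwardMarginal_eq_basisGaussian
    (b : OrthonormalBasis (Fin d) ℝ (EuclideanSpace ℝ (Fin d))) (μ : EuclideanSpace ℝ (Fin d))
    {S : Matrix (Fin d) (Fin d) ℝ} {lam : Fin d → ℝ} (hlam : ∀ i, 0 < lam i) (hS : S.PosSemidef)
    (hquad : ∀ x : EuclideanSpace ℝ (Fin d),
      WithLp.ofLp x ⬝ᵥ S *ᵥ WithLp.ofLp x = ∑ i, lam i * ⟪b i, x⟫ ^ 2) (η σ : ℝ → ℝ) (t : ℝ) :
    forwardMarginal (multivariateGaussian μ S) η σ t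
      = basisGaussian b (η t • μ) fun i => η t * √(lam i + σ t ^ 2) := by
  have h1 : IsProbabilityMeasure ((multivariateGaussian μ S).map (fun x => η t • x)) :=
    Measure.isProbabilityMeasure_map (by fun_prop)
  have h2 : IsProbabilityMeasure
      ((stdGaussian (EuclideanSpace ℝ (Fin d))).map (fun z => (η t * σ t) • z)) :=
    Measure.isProbabilityMeasure_map (by fun_prop)
  rw [forwardMarginal]
  refine Measure.ext_of_charFun (funext fun x => ?_)
  rw [charFun_conv, charFun_map_smul, charFun_map_smul, charFun_multivariateGaussian hS,
    charFun_stdGaussian, charFun_basisGaussian, ← Complex.exp_add]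
  congr 1
  have hq := hquad (η t • x)
  have hn : ‖(η t * σ t) • x‖ ^ 2 = ∑ i, (η t * σ t) ^ 2 * ⟪b i, x⟫ ^ 2 := by
    rw [norm_smul, mul_pow, Real.norm_eq_abs, sq_abs, ← b.sum_sq_inner_right x, Finset.mul_sum]
  have hs : ∑ i, (η t * √(lam i + σ t ^ 2)) ^ 2 * ⟪b i, x⟫ ^ 2
      = ∑ i, lam i * ⟪b i, η t • x⟫ ^ 2 + ‖(η t * σ t) • x‖ ^ 2 := by
    rw [hn, ← Finset.sum_add_distrib]
    refine Finset.sum_congr rfl fun i _ => ?_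
    rw [mul_pow, Real.sq_sqrt (lam_add_sq_pos (hlam i) _).le, inner_smul_right]
    ring
  rw [hq, hs, inner_smul_left, inner_smul_left, real_inner_comm]
  push_cast
  simp only [conj_trivial]
  ring

end Forward

/-! ### Coordinate moments of Gaussian vectors -/

section Moments

variable {d : ℕ} {b : OrthonormalBasis (Fin d) ℝ (EuclideanSpace ℝ (Fin d))}
  {Ω : Type u} [MeasurableSpace Ω] {P : Measure Ω} {X : Ω → EuclideanSpace ℝ (Fin d)}
  {m : EuclideanSpace ℝ (Fin d)} {r : Fin d → ℝ}

theorem memLp_inner_stdGaussian (x : EuclideanSpace ℝ (Fin d)) :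
    MemLp (fun z => ⟪x, z⟫) 2 (stdGaussian (EuclideanSpace ℝ (Fin d))) :=
  (innerSL ℝ x).comp_memLp' IsGaussian.memLp_two_id

theorem inner_affine_eq (i : Fin d) (z : EuclideanSpace ℝ (Fin d)) :
    ⟪b i, m + diagOp b r z⟫ = ⟪b i, m⟫ + r i * ⟪b i, z⟫ := by
  rw [inner_add_right, inner_diagOp]

theorem memLp_inner_of_map_eq_basisGaussian (hX : Measurable X)
    (hlaw : P.map X = basisGaussian b m r) (i : Fin d) :
    MemLp (fun o => ⟪b i, X o⟫) 2 P := by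
  have h : MemLp (fun x => ⟪b i, x⟫) 2 (basisGaussian b m r) := by
    rw [basisGaussian, memLp_map_measure_iff (by fun_prop) (by fun_prop)]
    have h1 : (fun x => ⟪b i, x⟫) ∘ (fun z => m + diagOp b r z)
        = fun z => ⟪b i, m⟫ + r i * ⟪b i, z⟫ := funext fun z => inner_affine_eq i z
    rw [h1]
    exact (memLp_const ⟪b i, m⟫).add ((memLp_inner_stdGaussian (b i)).const_mul _)
  rw [← hlaw] at h
  exact (memLp_map_measure_iff (by fun_prop) hX.aemeasurable).1 h

theorem integral_inner_of_map_eq_basisGaussian (hX : Measurable X)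
    (hlaw : P.map X = basisGaussian b m r) (i : Fin d) :
    ∫ o, ⟪b i, X o⟫ ∂P = ⟪b i, m⟫ := by
  rw [← integral_map (f := fun x => ⟪b i, x⟫) hX.aemeasurable (by fun_prop), hlaw, basisGaussian,
    integral_map (by fun_prop) (by fun_prop)]
  simp only [inner_affine_eq]
  rw [integral_add (integrable_const _)
    (((memLp_inner_stdGaussian (b i)).integrable (by norm_num)).const_mul _), integral_const_mul]
  have : ∫ z, ⟪b i, z⟫ ∂(stdGaussian (EuclideanSpace ℝ (Fin d))) = 0 :=
    integral_strongDual_stdGaussian (innerSL ℝ (b i))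
  simp [this]

theorem covariance_inner_of_map_eq_basisGaussian (hX : Measurable X)
    (hlaw : P.map X = basisGaussian b m r) (i j : Fin d) :
    cov[fun o => ⟪b i, X o⟫, fun o => ⟪b j, X o⟫; P] = if i = j then r i ^ 2 else 0 := by
  rw [← covariance_map_fun (X := fun x => ⟪b i, x⟫) (Y := fun x => ⟪b j, x⟫) (by fun_prop)
    (by fun_prop) hX.aemeasurable, hlaw, basisGaussian,
    covariance_map_fun (by fun_prop) (by fun_prop) (by fun_prop)]
  simp only [inner_affine_eq]
  have hint : ∀ k, Integrable (fun z => r k * ⟪b k, z⟫)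
      (stdGaussian (EuclideanSpace ℝ (Fin d))) := fun k =>
    ((memLp_inner_stdGaussian (b k)).integrable (by norm_num)).const_mul _
  rw [covariance_const_add_left (hint i), covariance_const_add_right (hint j),
    covariance_const_mul_left, covariance_const_mul_right,
    ← covarianceBilin_apply_eq_cov IsGaussian.memLp_two_id, covarianceBilin_stdGaussian,
    innerSL_apply_apply, b.inner_eq_ite]
  split_ifs with h
  · subst h; ring
  · ring

variable (b) in
theorem stdGaussian_eq_basisGaussian :
    stdGaussian (EuclideanSpace ℝ (Fin d)) = basisGaussian b 0 fun _ => 1 := by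
  have : (fun z => 0 + diagOp b (fun _ => 1) z) = id := funext fun z =>
    b.ext_inner fun j => by rw [inner_affine_eq, inner_zero_right, zero_add, one_mul, id]
  rw [basisGaussian, this, Measure.map_id]

end Moments

/-! ### Moments of the sampler in the eigenbasis of the data covariance -/

section Sampler

variable {d : ℕ} {T α : ℝ} {η σ : ℝ → ℝ}

/-- In an eigendirection of variance `lam i` the drift is an affine function of the coordinate. -/
theorem inner_reverseDrift (h : RegularSchedule T η σ)
    (b : OrthonormalBasis (Fin d) ℝ (EuclideanSpace ℝ (Fin d))) (μ : EuclideanSpace ℝ (Fin d))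
    {lam : Fin d → ℝ} (hlam : ∀ i, 0 < lam i) {pdata : Measure (EuclideanSpace ℝ (Fin d))}
    (hp : ∀ t, forwardMarginal pdata η σ t
      = basisGaussian b (η t • μ) fun i => η t * √(lam i + σ t ^ 2))
    {t : ℝ} (ht : T - t ∈ Icc 0 T) (y : EuclideanSpace ℝ (Fin d)) (i : Fin d) :
    ⟪b i, reverseDrift T α η σ pdata t y⟫ = -coeffQ T α η σ (lam i) (T - t) * ⟪b i, y⟫
      + (1 + α) * coeffB T σ (lam i) (T - t) * η (T - t) * ⟪b i, μ⟫ := by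
  have hη := (h.eta_pos _ ht).ne'
  have hpos : ∀ i, 0 < lam i + σ (T - t) ^ 2 := fun i => lam_add_sq_pos (hlam i) _
  rw [reverseDrift, hp, inner_add_right, inner_neg_right, inner_smul_right, inner_smul_right,
    inner_score_basisGaussian b _ fun i => mul_ne_zero hη (Real.sqrt_pos.2 (hpos i)).ne',
    inner_sub_right, inner_smul_right, mul_pow, Real.sq_sqrt (hpos i).le]
  have := (hpos i).ne'
  simp only [coeffQ, coeffB, diffusionRate]
  field_simp
  ring

variable {b : OrthonormalBasis (Fin d) ℝ (EuclideanSpace ℝ (Fin d))}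
  {Ω : Type u} [MeasurableSpace Ω] {P : Measure Ω}

theorem covariance_inner_noise {K : ℕ} {W : Fin K → Ω → EuclideanSpace ℝ (Fin d)}
    (hm : ∀ k, Measurable (W k)) (hlaw : ∀ k, P.map (W k) = stdGaussian _)
    (hind : iIndepFun W P) (k l : Fin K) (i j : Fin d) :
    cov[fun o => ⟪b i, W k o⟫, fun o => ⟪b j, W l o⟫; P] = if k = l ∧ i = j then 1 else 0 := by
  have hb : ∀ k, P.map (W k) = basisGaussian b 0 fun _ => 1 := fun k =>
    (hlaw k).trans (stdGaussian_eq_basisGaussian b)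
  by_cases hkl : k = l
  · subst hkl
    simp [covariance_inner_of_map_eq_basisGaussian (hm k) (hb k)]
  · rw [if_neg fun h => hkl h.1]
    exact ((hind.indepFun hkl).comp (φ := fun x => ⟪b i, x⟫) (ψ := fun x => ⟪b j, x⟫)
      (by fun_prop) (by fun_prop)).covariance_eq_zero
      (memLp_inner_of_map_eq_basisGaussian (hm k) (hb k) i)
      (memLp_inner_of_map_eq_basisGaussian (hm l) (hb l) j)

theorem covariance_inner_init_noise {K : ℕ} {W : Fin K → Ω → EuclideanSpace ℝ (Fin d)}
    {Y₀ : Ω → EuclideanSpace ℝ (Fin d)} {m : EuclideanSpace ℝ (Fin d)} {r : Fin d → ℝ}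
    (hm₀ : Measurable Y₀) (hlaw₀ : P.map Y₀ = basisGaussian b m r)
    (hm : ∀ k, Measurable (W k)) (hlaw : ∀ k, P.map (W k) = stdGaussian _)
    (hind : IndepFun Y₀ (fun o k => W k o) P) (l : Fin K) (i j : Fin d) :
    cov[fun o => ⟪b i, Y₀ o⟫, fun o => ⟪b j, W l o⟫; P] = 0 :=
  (hind.comp (φ := fun x => ⟪b i, x⟫)
    (ψ := fun w : Fin K → EuclideanSpace ℝ (Fin d) => ⟪b j, w l⟫)
    (by fun_prop) (by fun_prop)).covariance_eq_zero
    (memLp_inner_of_map_eq_basisGaussian hm₀ hlaw₀ i)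
    (memLp_inner_of_map_eq_basisGaussian (hm l)
      ((hlaw l).trans (stdGaussian_eq_basisGaussian b)) j)

/-- The coordinates of the iterates in the eigenbasis are uncorrelated, and their means and
variances follow the scalar schemes. The induction carries along that an iterate is uncorrelated
with the later noises, which replaces their independence. -/
theorem moments_eulerMaruyama [IsProbabilityMeasure P] (h : RegularSchedule T η σ)
    (hT : 0 < T) (hα : 0 ≤ α) (hσ : ∀ t ∈ Ioc 0 T, 0 ≤ σ t * dot T σ t)
    (μ : EuclideanSpace ℝ (Fin d))
    {lam : Fin d → ℝ} (hlam : ∀ i, 0 < lam i) {pdata : Measure (EuclideanSpace ℝ (Fin d))}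
    (hp : ∀ t, forwardMarginal pdata η σ t
      = basisGaussian b (η t • μ) fun i => η t * √(lam i + σ t ^ 2))
    {K : ℕ} {W : Fin K → Ω → EuclideanSpace ℝ (Fin d)} {Y : ℕ → Ω → EuclideanSpace ℝ (Fin d)}
    (hY : IsEulerMaruyama P T K (reverseDrift T α η σ pdata) (reverseDiffusion T α η σ)
      (forwardMarginal pdata η σ T) W Y) :
    ∀ k ≤ K, (∀ i, MemLp (fun o => ⟪b i, Y k o⟫) 2 P) ∧
      (∀ i, ∫ o, ⟪b i, Y k o⟫ ∂P
        = schemeSeq T (fun s => -coeffQ T α η σ (lam i) s) (fun _ => 0)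
          (fun s => (1 + α) * coeffB T σ (lam i) s * η s) (η T) K k * ⟪b i, μ⟫) ∧
      (∀ i j, cov[fun o => ⟪b i, Y k o⟫, fun o => ⟪b j, Y k o⟫; P]
        = if i = j then schemeSeq T (fun s => -2 * coeffQ T α η σ (lam i) s)
            (fun s => coeffQ T α η σ (lam i) s ^ 2) (fun s => 2 * α * diffusionRate T η σ s)
            (η T ^ 2 * (lam i + σ T ^ 2)) K k else 0) ∧
      (∀ (l : Fin K) (i j : Fin d), k ≤ l →
        cov[fun o => ⟪b i, Y k o⟫, fun o => ⟪b j, W l o⟫; P] = 0) := by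
  have hlaw₀ := hY.law_init.trans (hp T)
  have hlawW : ∀ k, P.map (W k) = basisGaussian b 0 fun _ => 1 := fun k =>
    (hY.law_noise k).trans (stdGaussian_eq_basisGaussian b)
  have hWL : ∀ (k : Fin K) (i : Fin d), MemLp (fun o => ⟪b i, W k o⟫) 2 P := fun k i =>
    memLp_inner_of_map_eq_basisGaussian (hY.measurable_noise k) (hlawW k) i
  intro k
  induction k with
  | zero =>
    refine fun _ => ⟨memLp_inner_of_map_eq_basisGaussian hY.measurable_init hlaw₀, fun i => ?_,
      fun i j => ?_, fun l i j _ => ?_⟩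
    · rw [integral_inner_of_map_eq_basisGaussian hY.measurable_init hlaw₀, inner_smul_right,
        schemeSeq]
    · rw [covariance_inner_of_map_eq_basisGaussian hY.measurable_init hlaw₀, schemeSeq, mul_pow,
        Real.sq_sqrt (lam_add_sq_pos (hlam i) _).le]
    · exact covariance_inner_init_noise hY.measurable_init hlaw₀ hY.measurable_noise hY.law_noise
        hY.indep_init l i j
  | succ k ih =>
    intro hk
    obtain ⟨ihL, ihm, ihc, ihw⟩ := ih (by omega)
    have hK : (0 : ℝ) < K := by exact_mod_cast (by omega : 0 < K)
    have hkK : (k : ℝ) < K := by exact_mod_cast hk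
    set γ := T / K with hγ
    have hγ0 : 0 < γ := by positivity
    have hγK : γ * K = T := by rw [hγ]; field_simp
    set s := T - γ * k with hs
    have hsm : s ∈ Ioc 0 T := by
      have : 0 ≤ γ * k := by positivity
      constructor
      · nlinarith
      · linarith
    -- one step in the coordinate `i` is `V ↦ c i + (a i * V + e * noise)`
    set κ : Fin K := ⟨k, hk⟩ with hκ
    set a : Fin d → ℝ := fun i => 1 - γ * coeffQ T α η σ (lam i) s with ha
    set c : Fin d → ℝ := fun i => γ * ((1 + α) * coeffB T σ (lam i) s * η s * ⟪b i, μ⟫) with hc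
    set e := √(2 * γ * reverseDiffusion T α η σ (γ * k)) with he
    have he2 : e ^ 2 = γ * (2 * α * diffusionRate T η σ s) := by
      have hnn : 0 ≤ diffusionRate T η σ s := by
        rw [diffusionRate, h.noiseRate_eq hsm]
        exact mul_nonneg (sq_nonneg _) (hσ s hsm)
      rw [he, reverseDiffusion, ← hs, Real.sq_sqrt (by positivity)]
      ring
    have hstep : ∀ i, (fun o => ⟪b i, Y (k + 1) o⟫)
        = fun o => c i + (a i * ⟪b i, Y k o⟫ + e * ⟪b i, W κ o⟫) := fun i => by
      funext o
      have := hY.step κ o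
      rw [show (κ : ℕ) = k from rfl] at this
      rw [this, inner_add_right, inner_add_right, inner_smul_right, inner_smul_right,
        inner_reverseDrift h b μ hlam hp (Ioc_subset_Icc_self hsm)]
      simp only [ha, hc, he, hs]
      ring
    have hVL : ∀ i, MemLp (fun o => a i * ⟪b i, Y k o⟫) 2 P := fun i => (ihL i).const_mul _
    have hEL : ∀ i, MemLp (fun o => e * ⟪b i, W κ o⟫) 2 P := fun i => (hWL κ i).const_mul _
    have hSL : ∀ i, MemLp (fun o => a i * ⟪b i, Y k o⟫ + e * ⟪b i, W κ o⟫) 2 P := fun i =>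
      (hVL i).add (hEL i)
    have hSI : ∀ i, Integrable (fun o => a i * ⟪b i, Y k o⟫ + e * ⟪b i, W κ o⟫) P := fun i =>
      (hSL i).integrable (by norm_num)
    refine ⟨fun i => ?_, fun i => ?_, fun i j => ?_, fun l i j hl => ?_⟩
    · rw [hstep]
      exact (memLp_const (c i)).add (hSL i)
    · rw [hstep, integral_add (integrable_const _) (hSI i),
        integral_add ((hVL i).integrable (by norm_num)) ((hEL i).integrable (by norm_num)),
        integral_const, integral_const_mul (a i), integral_const_mul e, ihm,
        integral_inner_of_map_eq_basisGaussian (hY.measurable_noise κ) (hlawW κ), inner_zero_right,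
        schemeSeq]
      simp only [probReal_univ, one_smul, ha, hc, ← hγ, ← hs]
      ring
    · rw [hstep, hstep, covariance_const_add_left (hSI i), covariance_const_add_right (hSI j)]
      change cov[(fun o => a i * ⟪b i, Y k o⟫) + (fun o => e * ⟪b i, W κ o⟫),
        (fun o => a j * ⟪b j, Y k o⟫) + (fun o => e * ⟪b j, W κ o⟫); P] = _
      rw [covariance_add_left (hVL i) (hEL i) ((hVL j).add (hEL j)),
        covariance_add_right (hVL i) (hVL j) (hEL j),
        covariance_add_right (hEL i) (hVL j) (hEL j)]
      simp only [covariance_const_mul_left, covariance_const_mul_right]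
      rw [ihc, ihw κ i j le_rfl, covariance_comm (fun o => ⟪b i, W κ o⟫), ihw κ j i le_rfl,
        covariance_inner_noise hY.measurable_noise hY.law_noise hY.indep_noise]
      by_cases hij : i = j
      · subst hij
        simp only [and_self, if_true, schemeSeq, ← hγ, ← hs, ha]
        linear_combination he2
      · simp [hij]
    · have hkl : κ ≠ l := fun hkl => by
        have := congrArg Fin.val hkl
        simp only [hκ] at this
        omega
      rw [hstep, covariance_const_add_left (hSI i)]
      change cov[(fun o => a i * ⟪b i, Y k o⟫) + (fun o => e * ⟪b i, W κ o⟫), _; P] = _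
      rw [covariance_add_left (hVL i) (hEL i) (hWL l j), covariance_const_mul_left,
        covariance_const_mul_left, ihw l i j (by omega),
        covariance_inner_noise hY.measurable_noise hY.law_noise hY.indep_noise]
      simp [hkl]

end Sampler

/-! ### Return to matrices -/

section Matrices

variable {d : ℕ} {U : Matrix (Fin d) (Fin d) ℝ}

/-- The columns of an orthogonal matrix form an orthonormal basis. -/
theorem exists_orthonormalBasis_of_mem_orthogonalGroup
    (hU : U ∈ Matrix.orthogonalGroup (Fin d) ℝ) :
    ∃ b : OrthonormalBasis (Fin d) ℝ (EuclideanSpace ℝ (Fin d)), ∀ i a, b i a = U a i := by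
  have hon : Orthonormal ℝ fun i => (WithLp.toLp 2 (Uᵀ i) : EuclideanSpace ℝ (Fin d)) := by
    rw [orthonormal_iff_ite]
    intro i j
    have := congrFun (congrFun ((Matrix.mem_orthogonalGroup_iff' (Fin d) ℝ).1 hU) i) j
    rw [Matrix.one_apply, Matrix.mul_apply] at this
    rw [← this]
    simp [PiLp.inner_apply, mul_comm]
  have hcard : Fintype.card (Fin d) = Module.finrank ℝ (EuclideanSpace ℝ (Fin d)) := by simp
  cases isEmpty_or_nonempty (Fin d) with
  | inl _ => exact ⟨EuclideanSpace.basisFun _ _, fun i => isEmptyElim i⟩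
  | inr _ =>
    have hcoe : ⇑(basisOfOrthonormalOfCardEqFinrank hon hcard)
        = fun i => (WithLp.toLp 2 (Uᵀ i) : EuclideanSpace ℝ (Fin d)) :=
      coe_basisOfOrthonormalOfCardEqFinrank hon hcard
    refine ⟨(basisOfOrthonormalOfCardEqFinrank hon hcard).toOrthonormalBasis 
      (by rw [hcoe]; exact hon),
      fun i a => ?_⟩
    rw [Module.Basis.coe_toOrthonormalBasis, hcoe]
    rfl

variable {b : OrthonormalBasis (Fin d) ℝ (EuclideanSpace ℝ (Fin d))}

theorem conj_diagonal_apply (f : Fin d → ℝ) (a c : Fin d) :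
    (U * Matrix.diagonal f * Uᵀ) a c = ∑ i, U a i * f i * U c i := by
  rw [Matrix.mul_apply]
  simp only [Matrix.mul_diagonal, Matrix.transpose_apply]

theorem toLp_conj_diagonal_mulVec (hb : ∀ i a, b i a = U a i) (f : Fin d → ℝ)
    (x : EuclideanSpace ℝ (Fin d)) :
    WithLp.toLp 2 ((U * Matrix.diagonal f * Uᵀ) *ᵥ WithLp.ofLp x) = diagOp b f x := by
  ext a
  have hx : ∀ i, ⟪b i, x⟫ = ∑ c, U c i * x c := fun i => by
    simp [PiLp.inner_apply, hb, mul_comm]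
  simp only [diagOp_apply, Matrix.mulVec, dotProduct, conj_diagonal_apply, WithLp.ofLp_sum,
    WithLp.ofLp_smul, Finset.sum_apply, Pi.smul_apply, smul_eq_mul, hb, hx, Finset.sum_mul,
    Finset.mul_sum]
  rw [Finset.sum_comm]
  exact Finset.sum_congr rfl fun i _ => Finset.sum_congr rfl fun c _ => by ring

theorem dotProduct_conj_diagonal_mulVec (hb : ∀ i a, b i a = U a i) (f : Fin d → ℝ)
    (x : EuclideanSpace ℝ (Fin d)) :
    WithLp.ofLp x ⬝ᵥ (U * Matrix.diagonal f * Uᵀ) *ᵥ WithLp.ofLp x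
      = ∑ i, f i * ⟪b i, x⟫ ^ 2 := by
  have h1 : WithLp.ofLp x ⬝ᵥ (U * Matrix.diagonal f * Uᵀ) *ᵥ WithLp.ofLp x
      = ⟪x, diagOp b f x⟫ := by
    rw [← toLp_conj_diagonal_mulVec hb]
    simp [PiLp.inner_apply, dotProduct, mul_comm]
  rw [h1, ← b.sum_inner_mul_inner]
  refine Finset.sum_congr rfl fun i _ => ?_
  rw [inner_diagOp, real_inner_comm]
  ring

/-- The covariance matrix of a vector whose coordinates in the basis `b` are uncorrelated. -/
theorem covMatrix_eq_conj_diagonal {Ω : Type u} [MeasurableSpace Ω] {P : Measure Ω}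
    [IsProbabilityMeasure P] (hb : ∀ i a, b i a = U a i) {X : Ω → EuclideanSpace ℝ (Fin d)}
    (hL : ∀ i, MemLp (fun o => ⟪b i, X o⟫) 2 P) {f : Fin d → ℝ}
    (hcov : ∀ i j, cov[fun o => ⟪b i, X o⟫, fun o => ⟪b j, X o⟫; P] = if i = j then f i else 0) :
    covMatrix P X = U * Matrix.diagonal f * Uᵀ := by
  ext a c
  have hX : ∀ a, (fun o => X o a) = fun o => ∑ i, U a i * ⟪b i, X o⟫ := fun a => by
    funext o
    conv_lhs => rw [← b.sum_repr' (X o)]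
    simp [hb, mul_comm]
  rw [covMatrix, Matrix.of_apply, hX a, hX c, covariance_fun_sum_fun_sum
    (fun i => (hL i).const_mul _) (fun i => (hL i).const_mul _), conj_diagonal_apply]
  simp only [covariance_const_mul_left, covariance_const_mul_right, hcov]
  refine Finset.sum_congr rfl fun i _ => ?_
  simp only [mul_ite, mul_zero, Finset.sum_ite_eq, Finset.mem_univ, if_true]
  ring

theorem memLp_of_forall_inner {Ω : Type u} [MeasurableSpace Ω] {P : Measure Ω}
    {X : Ω → EuclideanSpace ℝ (Fin d)} (hL : ∀ i, MemLp (fun o => ⟪b i, X o⟫) 2 P) :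
    MemLp X 2 P := by
  have hX : X = fun o => ∑ i, ⟪b i, X o⟫ • b i := funext fun o => (b.sum_repr' (X o)).symm
  rw [hX]
  exact memLp_finsetSum _ fun i _ =>
    (ContinuousLinearMap.toSpanSingleton ℝ (b i)).comp_memLp' (hL i)

end Matrices

/-! ### The error expansions -/

theorem proposition1 (T α : ℝ) (hT : 0 < T) (hα : 0 ≤ α) :
    -- decoupling and second-order expansions, for all schedules satisfying the regularity assumption
    (∀ η σ : ℝ → ℝ, RegularSchedule T η σ →
      (∀ t ∈ Ioc 0 T, 0 ≤ σ t * dot T σ t) →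
      ∃ Δmean Δcov : ℕ → ℝ → ℝ,
        -- for Gaussian data, the errors of the `K`-step sampler are diagonal in the eigenbasis `U`
        (∀ (d K : ℕ) (U : Matrix (Fin d) (Fin d) ℝ) (lam : Fin d → ℝ)
            (S : Matrix (Fin d) (Fin d) ℝ) (μ : EuclideanSpace ℝ (Fin d))
            (pdata : Measure (EuclideanSpace ℝ (Fin d))),
          0 < K → U ∈ Matrix.orthogonalGroup (Fin d) ℝ → (∀ i, 0 < lam i) →
          S = U * Matrix.diagonal lam * Uᵀ →
          pdata = multivariateGaussian μ S →
          ∀ (Ω : Type u) [MeasurableSpace Ω] (P : Measure Ω) [IsProbabilityMeasure P]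
            (W : Fin K → Ω → EuclideanSpace ℝ (Fin d)) (Y : ℕ → Ω → EuclideanSpace ℝ (Fin d)),
            IsEulerMaruyama P T K (reverseDrift T α η σ pdata) (reverseDiffusion T α η σ)
              (forwardMarginal pdata η σ T) W Y →
            MemLp (Y K) 2 P ∧
            ∫ o, Y K o ∂P = μ + WithLp.toLp 2
              ((U * Matrix.diagonal (fun i => Δmean K (lam i)) * Uᵀ) *ᵥ WithLp.ofLp μ) ∧
            covMatrix P (Y K) = S + U * Matrix.diagonal (fun i => Δcov K (lam i)) * Uᵀ) ∧
        -- small-stepsize expansions, with `γ = T / K`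
        (∀ lam : ℝ, 0 < lam →
          (fun K : ℕ => Δmean K lam
              - ((T / K) * meanCoeff1 T α η σ lam + (T / K) ^ 2 * meanCoeff2 T α η σ lam))
            =O[atTop] (fun K : ℕ => (T / K) ^ 3) ∧
          (fun K : ℕ => Δcov K lam
              - ((T / K) * covCoeff1 T α η σ lam + (T / K) ^ 2 * covCoeff2 T α η σ lam))
            =O[atTop] (fun K : ℕ => (T / K) ^ 3))) ∧
    -- the boundary terms vanish in the limit of large terminal noise
    (∀ (ι : Type v) (l : Filter ι) (η σ : ι → ℝ → ℝ),
      (∀ i, RegularSchedule T (η i) (σ i)) → LargeTerminalNoise T α l η σ →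
      ∀ lam : ℝ, 0 < lam →
        Tendsto (fun i => meanBoundary T α (η i) (σ i) lam) l (𝓝 0) ∧
        Tendsto (fun i => covBoundary T α (η i) (σ i) lam) l (𝓝 0)) := by
  refine ⟨fun η σ h hσ => ⟨meanError T α η σ, covError T α η σ, ?_, fun lam hlam =>
    ⟨meanError_isBigO h hT α hlam, covError_isBigO h hT α hlam⟩⟩,
    fun ι l η σ hreg hl lam hlam => meanBoundary_covBoundary_tendsto hT hα hreg hl hlam⟩
  rintro d K U lam S μ pdata - hU hlam rfl rfl Ω _ P _ W Y hY
  obtain ⟨b, hb⟩ := exists_orthonormalBasis_of_mem_orthogonalGroup hU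
  have hS : (U * Matrix.diagonal lam * Uᵀ).PosSemidef := by
    have := (Matrix.PosSemidef.diagonal fun i => (hlam i).le).mul_mul_conjTranspose_same U
    rwa [Matrix.conjTranspose_eq_transpose_of_trivial] at this
  have hp := forwardMarginal_eq_basisGaussian b μ hlam hS
    (dotProduct_conj_diagonal_mulVec hb lam) η σ
  obtain ⟨hL, hm, hc, -⟩ := moments_eulerMaruyama h hT hα hσ μ hlam hp hY K le_rfl
  have hL2 : MemLp (Y K) 2 P := memLp_of_forall_inner hL
  refine ⟨hL2, b.ext_inner fun j => ?_, ?_⟩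
  · rw [toLp_conj_diagonal_mulVec hb, inner_add_right, inner_diagOp,
      ← integral_inner (hL2.integrable (by norm_num)), hm, meanError]
    ring
  · rw [covMatrix_eq_conj_diagonal hb hL hc, ← add_mul, ← mul_add, Matrix.diagonal_add]
    simp only [covError, add_sub_cancel]
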